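/- All manifolds are smooth ($C^\infty$), finite-dimensional, Hausdorff and second countable. Let $G$ be a Lie group with identity $e$, let $\rho:G\times M\to M$ be a smooth (left) action on a manifold $M$ (not necessarily free or proper), write $\rho_m(g)=\rho(g,m)$, let $G_m$ be the isotropy subgroup of $m$, and let $\pi:M\to M/G$ be the canonical projection, where $M/G$ has the quotient topology. A point $m_0\in M$ is *$\rho$-regular* if $\dim G_m=\dim G_{m_0}$ for all $m$ in some open neighborhood of $m_0$. An open neighborhood $U$ of such a point $m_0$ is *admissible* if it is connected, $\dim G_m=\dim G_{m_0}$ for all $m\in U$, and the subspace $\pi(U)\subseteq M/G$ carries a manifold structure for which $\pi_{|U}:U\to\pi(U)$ is a submersion with $\mathsf{Ker}(\pi_{|U})_{*,m}=\mathsf{Im}(\rho_m)_{*,e}$ for all $m\in U$. **Theorem.** Let $m_0$ be a $\rho$-regular point, $U$ an admissible neighborhood of $m_0$, and $s:\pi(U)\to U$ a smooth section of $\pi_{|U}$ with $s(\pi(m_0))=m_0$. Then there are an admissible neighborhood $V\subseteq U$ of $m_0$ (where $\pi(V)$ has the manifold structure of an open subset of $\pi(U)$) with $s(\pi(V))\subseteq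 V$, and a map $\Theta:V\to G$, such that 1. $\Theta(V)$ is an embedded submanifold of $G$ and $\Theta:V\to\Theta(V)$ is a (surjective) submersion; 2. $\Theta$ is transverse to $\pi_{|V}$: $T_mV=\mathsf{Ker}(\pi_{|V})_{*,m}\oplus\mathsf{Ker}\,\Theta_{*,m}$ for all $m\in V$; 3. $\Theta(m_0)=e$ and $\rho(\Theta(m),s(\pi(m)))=m$ for all $m\in V$; 4. $\Theta$ can be constructed up to quadratures from $\rho$, $\pi_{|U}$ and $s$: $V$ and $\Theta(V)$ lie in the domains of given charts of $M$ at $m_0$ and of $G$ at $e$, and the expression of $\Theta$ in these charts is obtained, in finitely many steps, from the expressions of $\rho$, $\pi_{|U}$, $s$ in given charts at $(e,m_0)$, $m_0$, $\pi(m_0)$ by arithmetic operations (with real constants), composition, restriction to open subsets, differentiation, taking primitives, and inverting functions to which the Inverse Function Theorem applies. -/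

import Mathlib

open scoped Manifold ContDiff Topology

/-! ### Manifolds and submanifolds -/

/-- `X`, with the given charts, is a smooth `n`-dimensional manifold
(Hausdorff, second countable, without boundary). -/
structure IsSmoothManifold (n : ℕ) (X : Type*) [TopologicalSpace X]
    [ChartedSpace (EuclideanSpace ℝ (Fin n)) X] : Prop where
  t2 : T2Space X
  secondCountable : SecondCountableTopology X
  smooth : IsManifold (𝓡 n) ∞ X

/-- The subset `S` of the `n`-manifold `N`, with the subspace topology and the given charts, is an
embedded `k`-dimensional submanifold. -/
structure IsEmbeddedSubmanifold (n k : ℕ) {N : Type*} [TopologicalSpace N]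
    [ChartedSpace (EuclideanSpace ℝ (Fin n)) N] (S : Set N)
    [ChartedSpace (EuclideanSpace ℝ (Fin k)) S] : Prop where
  manifold : IsSmoothManifold k S
  embedding : Manifold.IsSmoothEmbedding (𝓡 k) (𝓡 n) ∞ (Subtype.val : S → N)

/-- `S` is an embedded submanifold of dimension `k`. For the isotropy subgroups, which are closed,
this `k` is their dimension as Lie subgroups. -/
def HasSubmanifoldDim (n : ℕ) {N : Type*} [TopologicalSpace N]
    [ChartedSpace (EuclideanSpace ℝ (Fin n)) N] (S : Set N) (k : ℕ) : Prop :=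
  ∃ _ : ChartedSpace (EuclideanSpace ℝ (Fin k)) S, IsEmbeddedSubmanifold n k S

/-- Two maps `f : P → N` and `g : P → L` are transverse: `T P = Ker f_* ⊕ Ker g_*`. -/
def AreTransverse (p n l : ℕ) {P N L : Type*}
    [TopologicalSpace P] [ChartedSpace (EuclideanSpace ℝ (Fin p)) P]
    [TopologicalSpace N] [ChartedSpace (EuclideanSpace ℝ (Fin n)) N]
    [TopologicalSpace L] [ChartedSpace (EuclideanSpace ℝ (Fin l)) L]
    (f : P → N) (g : P → L) : Prop :=
  ∀ x : P, IsCompl (LinearMap.ker (mfderiv (𝓡 p) (𝓡 n) f x).toLinearMap)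
    (LinearMap.ker (mfderiv (𝓡 p) (𝓡 l) g x).toLinearMap)

/-! ### The orbit projection and admissible neighborhoods -/

section Action

variable (G : Type*) [Group G] {M : Type*} [TopologicalSpace M] [MulAction G M]

/-- `π(U)`, as a subset of the orbit space `M / G` with the quotient topology. -/
def orbitImage (U : TopologicalSpace.Opens M) : Set (MulAction.orbitRel.Quotient G M) :=
  (fun m : M => (Quotient.mk (MulAction.orbitRel G M) m : MulAction.orbitRel.Quotient G M)) '' U

/-- The restricted projection `π|_U : U → π(U)`. -/
def orbitProj (U : TopologicalSpace.Opens M) (m : U) : orbitImage G U :=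
  ⟨Quotient.mk (MulAction.orbitRel G M) (m : M), ⟨m, m.2, rfl⟩⟩

theorem orbitImage_mono {V U : TopologicalSpace.Opens M} (h : V ≤ U) :
    orbitImage G V ⊆ orbitImage G U :=
  Set.image_mono h

variable (d r : ℕ) [TopologicalSpace G] [ChartedSpace (EuclideanSpace ℝ (Fin d)) G]
  [ChartedSpace (EuclideanSpace ℝ (Fin r)) M]

/-- `dim G_m = dim G_{m₀}` for every `m` in `U`. -/
def ConstantIsotropyDim (m₀ : M) (U : TopologicalSpace.Opens M) : Prop :=
  ∃ k : ℕ, HasSubmanifoldDim d (MulAction.stabilizer G m₀ : Set G) k ∧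
    ∀ m ∈ U, HasSubmanifoldDim d (MulAction.stabilizer G m : Set G) k

/-- `m₀` is a regular point of the action. -/
def IsRegularPoint (m₀ : M) : Prop :=
  ∃ U : TopologicalSpace.Opens M, m₀ ∈ U ∧ ConstantIsotropyDim G d m₀ U

/-- `U` is an admissible neighborhood of `m₀`, where `π(U)` (with the topology induced by the
quotient topology of `M / G`) carries the given `q`-dimensional charts. -/
structure IsAdmissible (q : ℕ) (m₀ : M) (U : TopologicalSpace.Opens M)
    [ChartedSpace (EuclideanSpace ℝ (Fin q)) (orbitImage G U)] : Prop where
  mem : m₀ ∈ U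
  connected : IsConnected (U : Set M)
  isotropy : ConstantIsotropyDim G d m₀ U
  manifold : IsSmoothManifold q (orbitImage G U)
  submersion : Manifold.IsSubmersion (𝓡 r) (𝓡 q) ∞ (orbitProj G U)
  /-- `Ker (π|_U)_{*,m} = Im (ρ_m)_{*,e}`, where `ρ_m g = g • m`; the derivative of the inclusion
  `U → M` identifies `T_m U` with `T_m M`. -/
  ker_eq : ∀ (m : U) (v : TangentSpace (𝓡 r) m),
    mfderiv (𝓡 r) (𝓡 q) (orbitProj G U) m v = 0 ↔
      ∃ ξ : TangentSpace (𝓡 d) (1 : G),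
        mfderiv (𝓡 d) (𝓡 r) (fun g : G => g • (m : M)) 1 ξ =
          mfderiv (𝓡 r) (𝓡 r) (Subtype.val : U → M) m v

end Action

/-! ### Construction up to quadratures -/

/-- A family of known functions: `K A f` says that `f`, as a function with domain `A`, is known. -/
abbrev KnownFamily : Type 1 :=
  ∀ (E F : Type) [NormedAddCommGroup E] [NormedSpace ℝ E]
    [NormedAddCommGroup F] [NormedSpace ℝ F], Set E → (E → F) → Prop

/-- `f`, as a function with domain `A`, can be constructed up to quadratures from the known
functions `K`: it is obtained in finitely many steps by arithmetic operations (with real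
constants), derivatives, primitives, and inverses of functions to which the Inverse Function Theorem
applies. Only the values of `f` on `A` matter. -/
inductive ConstructibleUpToQuadratures (K : KnownFamily) : KnownFamily
  | known {E F : Type} [NormedAddCommGroup E] [NormedSpace ℝ E]
      [NormedAddCommGroup F] [NormedSpace ℝ F] {A : Set E} {f : E → F} (h : K E F A f) :
      ConstructibleUpToQuadratures K E F A f
  | affine {E F : Type} [NormedAddCommGroup E] [NormedSpace ℝ E] [FiniteDimensional ℝ E]
      [NormedAddCommGroup F] [NormedSpace ℝ F] [FiniteDimensional ℝ F] (L : E →L[ℝ] F) (c : F) :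
      ConstructibleUpToQuadratures K E F Set.univ (fun x => L x + c)
  | restrict {E F : Type} [NormedAddCommGroup E] [NormedSpace ℝ E]
      [NormedAddCommGroup F] [NormedSpace ℝ F] {A B : Set E} {f g : E → F}
      (hf : ConstructibleUpToQuadratures K E F A f) (hB : IsOpen B) (hBA : B ⊆ A)
      (hfg : Set.EqOn f g B) : ConstructibleUpToQuadratures K E F B g
  | comp {E F H : Type} [NormedAddCommGroup E] [NormedSpace ℝ E]
      [NormedAddCommGroup F] [NormedSpace ℝ F] [NormedAddCommGroup H] [NormedSpace ℝ H]
      {A : Set E} {B : Set F} {f : E → F} {g : F → H}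
      (hf : ConstructibleUpToQuadratures K E F A f)
      (hg : ConstructibleUpToQuadratures K F H B g) (hAB : Set.MapsTo f A B) :
      ConstructibleUpToQuadratures K E H A (g ∘ f)
  | pair {E F H : Type} [NormedAddCommGroup E] [NormedSpace ℝ E]
      [NormedAddCommGroup F] [NormedSpace ℝ F] [NormedAddCommGroup H] [NormedSpace ℝ H]
      {A : Set E} {f : E → F} {g : E → H}
      (hf : ConstructibleUpToQuadratures K E F A f)
      (hg : ConstructibleUpToQuadratures K E H A g) :
      ConstructibleUpToQuadratures K E (F × H) A (fun x => (f x, g x))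
  | mul {E : Type} [NormedAddCommGroup E] [NormedSpace ℝ E] {A : Set E} {f g : E → ℝ}
      (hf : ConstructibleUpToQuadratures K E ℝ A f)
      (hg : ConstructibleUpToQuadratures K E ℝ A g) :
      ConstructibleUpToQuadratures K E ℝ A (fun x => f x * g x)
  | inv {E : Type} [NormedAddCommGroup E] [NormedSpace ℝ E] {A : Set E} {f : E → ℝ}
      (hf : ConstructibleUpToQuadratures K E ℝ A f) (h0 : ∀ x ∈ A, f x ≠ 0) :
      ConstructibleUpToQuadratures K E ℝ A (fun x => (f x)⁻¹)
  | derivative {E F : Type} [NormedAddCommGroup E] [NormedSpace ℝ E]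
      [NormedAddCommGroup F] [NormedSpace ℝ F] {A : Set E} {f : E → F}
      (hf : ConstructibleUpToQuadratures K E F A f) (hA : IsOpen A) (hs : ContDiffOn ℝ ∞ f A)
      (v : E) : ConstructibleUpToQuadratures K E F A (fun x => fderiv ℝ f x v)
  /-- The primitive `(x, t) ↦ ∫_c^t f (x, τ) dτ` in one variable, the others being parameters. -/
  | primitive {E F : Type} [NormedAddCommGroup E] [NormedSpace ℝ E]
      [NormedAddCommGroup F] [NormedSpace ℝ F] {A : Set (E × ℝ)} {f : E × ℝ → F}
      (hf : ConstructibleUpToQuadratures K (E × ℝ) F A f) (hA : IsOpen A)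
      (hs : ContDiffOn ℝ ∞ f A) (c : ℝ)
      (hc : ∀ p ∈ A, ∀ τ ∈ Set.uIcc c p.2, (p.1, τ) ∈ A) :
      ConstructibleUpToQuadratures K (E × ℝ) F A (fun p => ∫ τ in c..p.2, f (p.1, τ))
  | inverse {E F : Type} [NormedAddCommGroup E] [NormedSpace ℝ E]
      [NormedAddCommGroup F] [NormedSpace ℝ F] {A : Set E} {f : E → F} {g : F → E}
      (hf : ConstructibleUpToQuadratures K E F A f) (hA : IsOpen A) (hs : ContDiffOn ℝ ∞ f A)
      (hd : ∀ x ∈ A, Function.Bijective (fderiv ℝ f x)) (hg : ∀ x ∈ A, g (f x) = x) :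
      ConstructibleUpToQuadratures K F E (f '' A) g

/-- The domain of the expression of `f` in the preferred charts at `x` and `f x`. -/
def coordDomain {H H' X Y : Type*} [TopologicalSpace H] [TopologicalSpace H']
    {E F : Type} [NormedAddCommGroup E] [NormedSpace ℝ E] [NormedAddCommGroup F] [NormedSpace ℝ F]
    (I : ModelWithCorners ℝ E H) (J : ModelWithCorners ℝ F H')
    [TopologicalSpace X] [ChartedSpace H X] [TopologicalSpace Y] [ChartedSpace H' Y]
    (x : X) (f : X → Y) : Set E :=
  (extChartAt I x).target ∩ (extChartAt I x).symm ⁻¹' (f ⁻¹' (extChartAt J (f x)).source)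

/-- The known functions of the problem: the coordinate expressions of the action `ρ` near
`(e, m₀)`, of the projection `π|_U` near `m₀`, and of the section `s` near `π(m₀)`. -/
inductive ActionData (d r q : ℕ) {G M : Type*} [Group G] [TopologicalSpace G]
    [ChartedSpace (EuclideanSpace ℝ (Fin d)) G] [TopologicalSpace M]
    [ChartedSpace (EuclideanSpace ℝ (Fin r)) M] [MulAction G M]
    (U : TopologicalSpace.Opens M) [ChartedSpace (EuclideanSpace ℝ (Fin q)) (orbitImage G U)]
    (m₀ : U) (s : orbitImage G U → U) : KnownFamily
  | action : ActionData d r q U m₀ s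
      (EuclideanSpace ℝ (Fin d) × EuclideanSpace ℝ (Fin r)) (EuclideanSpace ℝ (Fin r))
      (coordDomain ((𝓡 d).prod (𝓡 r)) (𝓡 r) ((1 : G), (m₀ : M)) (fun p : G × M => p.1 • p.2))
      (writtenInExtChartAt ((𝓡 d).prod (𝓡 r)) (𝓡 r) ((1 : G), (m₀ : M))
        (fun p : G × M => p.1 • p.2))
  | projection : ActionData d r q U m₀ s
      (EuclideanSpace ℝ (Fin r)) (EuclideanSpace ℝ (Fin q))
      (coordDomain (𝓡 r) (𝓡 q) m₀ (orbitProj G U))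
      (writtenInExtChartAt (𝓡 r) (𝓡 q) m₀ (orbitProj G U))
  | localSection : ActionData d r q U m₀ s
      (EuclideanSpace ℝ (Fin q)) (EuclideanSpace ℝ (Fin r))
      (coordDomain (𝓡 q) (𝓡 r) (orbitProj G U m₀) s)
      (writtenInExtChartAt (𝓡 q) (𝓡 r) (orbitProj G U m₀) s)

/-- `f : X → Y` can be constructed up to quadratures from `K`: `X` and `f(X)` lie in the domains of
the preferred charts at `x₀` and `f x₀`, and the expression of `f` in these charts can be
constructed. -/
def MapConstructible (n l : ℕ) (K : KnownFamily) {X Y : Type*}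
    [TopologicalSpace X] [ChartedSpace (EuclideanSpace ℝ (Fin n)) X]
    [TopologicalSpace Y] [ChartedSpace (EuclideanSpace ℝ (Fin l)) Y] (x₀ : X) (f : X → Y) : Prop :=
  (∀ x, x ∈ (extChartAt (𝓡 n) x₀).source ∧ f x ∈ (extChartAt (𝓡 l) (f x₀)).source) ∧
    ConstructibleUpToQuadratures K (EuclideanSpace ℝ (Fin n)) (EuclideanSpace ℝ (Fin l))
      (extChartAt (𝓡 n) x₀).target (writtenInExtChartAt (𝓡 n) (𝓡 l) x₀ f)

/-! Near `m₀` every point is to be written as g • s(y), where y is its orbit and g depends smoothly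
on the point. Since g is ambiguous up to isotropy, it is confined to a slice of G at e. Let T be the
derivative of g ↦ g • m₀ at e in the chart of G, let C be a linear complement of Ker T, and let g(u)
be the element with coordinates c + L u, where c are the coordinates of e and L identifies ℝ^k with
C.

The map (u, y) ↦ g(u) • s(y), called `sliceParam`, is a local diffeomorphism at the base point (0,
π(m₀)). Let P be its derivative there and B that of π. From π(g(u) • s(y)) = y it follows that B P
is the second projection, and in the u-direction P equals T L. So P(u, w) = 0 forces w = 0, then T L
u = 0, then u = 0. The kernel condition on π gives Im T = Ker B, hence k = rank T = r - q, and the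
injective P is invertible for dimension reasons.

Inverting `sliceParam` on a ball gives a chart (u, y) of M on an open set V, and Θ(m) = g(u). In
this chart π is the projection to y and Θ is the projection to u, while Θ(V) is a piece of an affine
subspace in the chart of G. Submersion, transversality and embeddedness are then statements about
linear projections. For the max norm a ball is a product, so it contains (0, y) along with (u, y),
which gives s(π(V)) ⊆ V. In coordinates Θ needs only compositions of ρ and s with affine maps, one
inverse, and a final affine map.

The argument rests on `exists_hasMFDerivAt_orbit_exact`, `exists_hasMFDerivAt_sliceParam`,
`ContinuousLinearMap.exists_complement_of_exact` and `exists_sliceChart`; `mapConstructible_theta`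
gives the quadratures. -/

/-! ### Inverse function theorem in normed spaces -/

/-- The inverse function theorem on a ball: a smooth map with invertible derivative at `a` restricts
to a diffeomorphism from a ball around `a`. -/
theorem ContDiffOn.exists_openPartialHomeomorph_ball {E F : Type*} [NormedAddCommGroup E]
    [NormedSpace ℝ E] [CompleteSpace E] [NormedAddCommGroup F] [NormedSpace ℝ F]
    {f : E → F} {D : Set E} (hf : ContDiffOn ℝ ∞ f D) (hD : IsOpen D) {a : E} (ha : a ∈ D)
    (hf' : ∃ f' : E ≃L[ℝ] F, fderiv ℝ f a = f') :
    ∃ (Φ : OpenPartialHomeomorph E F) (ε : ℝ), 0 < ε ∧ ⇑Φ = f ∧ Φ.source = Metric.ball a ε ∧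
      Metric.ball a ε ⊆ D ∧ ContDiffOn ℝ ∞ Φ.symm Φ.target := by
  obtain ⟨f', hf'⟩ := hf'
  have hfa : ContDiffAt ℝ ∞ f a := hf.contDiffAt (hD.mem_nhds ha)
  have hfd : HasFDerivAt f (f' : E →L[ℝ] F) a :=
    hf' ▸ (hfa.differentiableAt (by simp)).hasFDerivAt
  let Ψ := hfa.toOpenPartialHomeomorph f hfd (by simp)
  have haΨ : a ∈ Ψ.source := hfa.mem_toOpenPartialHomeomorph_source hfd (by simp)
  have hcont : ContinuousAt (fderiv ℝ f) a :=
    ((hf.continuousOn_fderiv_of_isOpen hD (by simp)).continuousAt (hD.mem_nhds ha))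
  -- Invertibility is an open condition, so the ball can be shrunk until the derivative is
  -- invertible at each of its points; this makes the inverse smooth on its whole domain, not only
  -- at `f a`.
  have hiso : ∀ᶠ x in 𝓝 a, fderiv ℝ f x ∈ Set.range
      (ContinuousLinearEquiv.toContinuousLinearMap : (E ≃L[ℝ] F) → (E →L[ℝ] F)) :=
    hcont.eventually (hf' ▸ f'.nhds)
  obtain ⟨ε, hε, hball⟩ := Metric.eventually_nhds_iff_ball.1
    (hiso.and ((hD.eventually_mem ha).and (Ψ.open_source.eventually_mem haΨ)))
  refine ⟨Ψ.restrOpen (Metric.ball a ε) Metric.isOpen_ball, ε, hε, rfl, ?_,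
    fun x hx => (hball x hx).2.1, ?_⟩
  · rw [OpenPartialHomeomorph.restrOpen_source]
    exact Set.inter_eq_right.2 fun x hx => (hball x hx).2.2
  · intro y hy
    have hx := (Ψ.restrOpen (Metric.ball a ε) Metric.isOpen_ball).map_target hy
    rw [OpenPartialHomeomorph.restrOpen_source] at hx
    obtain ⟨⟨g', hg'⟩, hxD, -⟩ := hball _ hx.2
    have hfx : ContDiffAt ℝ ∞ f _ := hf.contDiffAt (hD.mem_nhds hxD)
    exact ((Ψ.restrOpen (Metric.ball a ε) Metric.isOpen_ball).contDiffAt_symm hy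
      (hg' ▸ (hfx.differentiableAt (by simp)).hasFDerivAt) hfx).contDiffWithinAt

/-- The derivative of a diffeomorphism between open subsets of normed spaces is bijective. -/
theorem OpenPartialHomeomorph.bijective_fderiv {E F : Type*} [NormedAddCommGroup E]
    [NormedSpace ℝ E] [NormedAddCommGroup F] [NormedSpace ℝ F] (Φ : OpenPartialHomeomorph E F)
    (h : ContDiffOn ℝ ∞ Φ Φ.source) (h' : ContDiffOn ℝ ∞ Φ.symm Φ.target) {x : E}
    (hx : x ∈ Φ.source) : Function.Bijective (fderiv ℝ Φ x) := by
  have hΦ : OpenPartialHomeomorph.MDifferentiable 𝓘(ℝ, E) 𝓘(ℝ, F) Φ :=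
    ⟨(h.contMDiffOn).mdifferentiableOn (by simp), (h'.contMDiffOn).mdifferentiableOn (by simp)⟩
  have hbij := hΦ.mfderiv_bijective hx
  rw [mfderiv_eq_fderiv] at hbij
  exact hbij

/-! ### Extending maps from an open subset -/

namespace TopologicalSpace.Opens

variable {r : ℕ} {M : Type*} [TopologicalSpace M] [ChartedSpace (EuclideanSpace ℝ (Fin r)) M]

open Classical in
/-- A map `M → U` that is the identity on `U`. -/
noncomputable def retract (U : Opens M) (x₀ : U) (x : M) : U :=
  if h : x ∈ U then ⟨x, h⟩ else x₀

theorem retract_of_mem {U : Opens M} (x₀ : U) {x : M} (h : x ∈ U) : U.retract x₀ x = ⟨x, h⟩ :=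
  dif_pos h

theorem retract_coe {U : Opens M} (x₀ x : U) : U.retract x₀ x = x :=
  retract_of_mem x₀ x.2

theorem contMDiffAt_retract {U : Opens M} (x₀ : U) {x : M} (hx : x ∈ U) :
    ContMDiffAt (𝓡 r) (𝓡 r) ∞ (U.retract x₀) x := by
  have h : ContMDiffAt (𝓡 r) (𝓡 r) ∞ (fun y : U => U.retract x₀ y) ⟨x, hx⟩ := by
    simp only [retract_coe]
    exact contMDiffAt_id
  exact contMDiffAt_subtype_iff.1 h

end TopologicalSpace.Opens

/-! ### Submersions and transversality in global charts -/

section SingleChart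

variable {n p q : ℕ} {X Y N : Type*} [TopologicalSpace X] [TopologicalSpace Y] [TopologicalSpace N]
  [ChartedSpace (EuclideanSpace ℝ (Fin n)) N]
  [ChartedSpace (EuclideanSpace ℝ (Fin p)) X] [ChartedSpace (EuclideanSpace ℝ (Fin q)) Y]

/-- A map that is a linear projection in global charts is a submersion. -/
theorem isSubmersion_of_global_charts {F : Type} [NormedAddCommGroup F] [NormedSpace ℝ F]
    (ψ : OpenPartialHomeomorph N (EuclideanSpace ℝ (Fin n)))
    (hψ : ψ ∈ IsManifold.maximalAtlas (𝓡 n) ∞ N) (hψs : ψ.source = Set.univ)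
    (e : OpenPartialHomeomorph X (EuclideanSpace ℝ (Fin p)))
    (he : e ∈ IsManifold.maximalAtlas (𝓡 p) ∞ X) (hes : e.source = Set.univ)
    (T : EuclideanSpace ℝ (Fin n) ≃L[ℝ] EuclideanSpace ℝ (Fin p) × F)
    {f : N → X} (hf : ∀ x, e (f x) = (T (ψ x)).1) :
    Manifold.IsSubmersion (𝓡 n) (𝓡 p) ∞ f := by
  refine Manifold.IsSubmersionOfComplement.isSubmersion (F := F) fun x => ?_
  refine Manifold.IsSubmersionAtOfComplement.mk_of_charts T ψ e (by simp [hψs]) (by simp [hes]) hψ he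
    (by simp [hes]) ?_
  intro z hz
  have hz' : z ∈ ψ.target := by simpa using hz
  simp [hf, ψ.right_inv hz']

theorem OpenPartialHomeomorph.bijective_mfderiv_of_mem_maximalAtlas [IsManifold (𝓡 n) ∞ N]
    (ψ : OpenPartialHomeomorph N (EuclideanSpace ℝ (Fin n)))
    (hψ : ψ ∈ IsManifold.maximalAtlas (𝓡 n) ∞ N) {x : N} (hx : x ∈ ψ.source) :
    Function.Bijective (mfderiv (𝓡 n) (𝓡 n) ψ x) := by
  have h : OpenPartialHomeomorph.MDifferentiable (𝓡 n) (𝓡 n) ψ :=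
    ⟨(contMDiffOn_of_mem_maximalAtlas hψ).mdifferentiableOn (by simp),
      (contMDiffOn_symm_of_mem_maximalAtlas hψ).mdifferentiableOn (by simp)⟩
  exact h.mfderiv_bijective hx

/-- Differentiate `e ∘ f = A ∘ ψ` and cancel the bijective derivative of `e`. Kernels of derivatives
thereby become kernels of linear maps. -/
theorem mfderiv_eq_zero_iff_of_global_charts [IsManifold (𝓡 n) ∞ N] [IsManifold (𝓡 p) ∞ X]
    (ψ : OpenPartialHomeomorph N (EuclideanSpace ℝ (Fin n)))
    (hψ : ψ ∈ IsManifold.maximalAtlas (𝓡 n) ∞ N) (hψs : ψ.source = Set.univ)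
    (e : OpenPartialHomeomorph X (EuclideanSpace ℝ (Fin p)))
    (he : e ∈ IsManifold.maximalAtlas (𝓡 p) ∞ X) (hes : e.source = Set.univ)
    (A : EuclideanSpace ℝ (Fin n) →L[ℝ] EuclideanSpace ℝ (Fin p))
    {f : N → X} (hfs : ContMDiff (𝓡 n) (𝓡 p) ∞ f) (hf : ∀ x, e (f x) = A (ψ x)) (x : N)
    (v : TangentSpace (𝓡 n) x) :
    mfderiv (𝓡 n) (𝓡 p) f x v = 0 ↔ A (mfderiv (𝓡 n) (𝓡 n) ψ x v) = 0 := by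
  have h1 : HasMFDerivAt (𝓡 n) (𝓡 p) f x (mfderiv (𝓡 n) (𝓡 p) f x) :=
    ((hfs x).mdifferentiableAt (by simp)).hasMFDerivAt
  have h2 : HasMFDerivAt (𝓡 p) (𝓡 p) e (f x) (mfderiv (𝓡 p) (𝓡 p) e (f x)) :=
    ((contMDiffAt_of_mem_maximalAtlas he (by simp [hes])).mdifferentiableAt (by simp)).hasMFDerivAt
  have h3 : HasMFDerivAt (𝓡 n) (𝓡 n) ψ x (mfderiv (𝓡 n) (𝓡 n) ψ x) :=
    ((contMDiffAt_of_mem_maximalAtlas hψ (by simp [hψs])).mdifferentiableAt (by simp)).hasMFDerivAt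
  have h4 : HasMFDerivAt (𝓡 n) (𝓡 p) A (ψ x) A := A.hasMFDerivAt
  have hfe : e ∘ f = A ∘ ψ := funext hf
  have h5 := h2.comp x h1
  rw [hfe] at h5
  have h6 := congrArg (fun L => L v) (hasMFDerivAt_unique h5 (h4.comp x h3))
  have hbij := e.bijective_mfderiv_of_mem_maximalAtlas he (x := f x) (by simp [hes])
  constructor
  · intro h
    refine h6.symm.trans ?_
    change mfderiv (𝓡 p) (𝓡 p) e (f x) (mfderiv (𝓡 n) (𝓡 p) f x v) = 0
    rw [h, map_zero]
  · intro h
    apply hbij.1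
    rw [map_zero]
    exact h6.trans h

/-- Two maps that are complementary linear projections in global charts are transverse. -/
theorem areTransverse_of_global_charts [IsManifold (𝓡 n) ∞ N] [IsManifold (𝓡 p) ∞ X]
    [IsManifold (𝓡 q) ∞ Y]
    (ψ : OpenPartialHomeomorph N (EuclideanSpace ℝ (Fin n)))
    (hψ : ψ ∈ IsManifold.maximalAtlas (𝓡 n) ∞ N) (hψs : ψ.source = Set.univ)
    (e : OpenPartialHomeomorph X (EuclideanSpace ℝ (Fin p)))
    (he : e ∈ IsManifold.maximalAtlas (𝓡 p) ∞ X) (hes : e.source = Set.univ)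
    (e' : OpenPartialHomeomorph Y (EuclideanSpace ℝ (Fin q)))
    (he' : e' ∈ IsManifold.maximalAtlas (𝓡 q) ∞ Y) (hes' : e'.source = Set.univ)
    (T : EuclideanSpace ℝ (Fin n) ≃L[ℝ] EuclideanSpace ℝ (Fin p) × EuclideanSpace ℝ (Fin q))
    {f : N → X} (hfs : ContMDiff (𝓡 n) (𝓡 p) ∞ f) (hf : ∀ x, e (f x) = (T (ψ x)).1)
    {g : N → Y} (hgs : ContMDiff (𝓡 n) (𝓡 q) ∞ g) (hg : ∀ x, e' (g x) = (T (ψ x)).2) :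
    AreTransverse n p q f g := by
  intro x
  have hF : ∀ v, mfderiv (𝓡 n) (𝓡 p) f x v = 0 ↔ (T (mfderiv (𝓡 n) (𝓡 n) ψ x v)).1 = 0 :=
    mfderiv_eq_zero_iff_of_global_charts ψ hψ hψs e he hes
      ((ContinuousLinearMap.fst ℝ _ _).comp T.toContinuousLinearMap) hfs hf x
  have hG : ∀ v, mfderiv (𝓡 n) (𝓡 q) g x v = 0 ↔ (T (mfderiv (𝓡 n) (𝓡 n) ψ x v)).2 = 0 :=
    mfderiv_eq_zero_iff_of_global_charts ψ hψ hψs e' he' hes'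
      ((ContinuousLinearMap.snd ℝ _ _).comp T.toContinuousLinearMap) hgs hg x
  have hbij := ψ.bijective_mfderiv_of_mem_maximalAtlas hψ (x := x) (by simp [hψs])
  constructor
  · rw [Submodule.disjoint_def]
    intro v hv hv'
    have h1 := (hF v).1 hv
    have h2 := (hG v).1 hv'
    apply hbij.1
    rw [map_zero]
    exact (map_eq_zero_iff T T.injective).1 (Prod.ext h1 h2)
  · rw [codisjoint_iff, eq_top_iff]
    intro v _
    -- `w` keeps the second component of `v` and has first component zero, so `w` lies in the kernel
    -- of `f_*` and `v - w` in that of `g_*`.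
    obtain ⟨w, hw⟩ := hbij.2 (T.symm (0, (T (mfderiv (𝓡 n) (𝓡 n) ψ x v)).2))
    have hw1 : w ∈ LinearMap.ker (mfderiv (𝓡 n) (𝓡 p) f x).toLinearMap :=
      (hF w).2 (by rw [hw]; simp)
    have hw2 : v - w ∈ LinearMap.ker (mfderiv (𝓡 n) (𝓡 q) g x).toLinearMap := by
      refine (hG (v - w)).2 ?_
      rw [map_sub, hw]
      erw [map_sub]
      simp
    rw [← add_sub_cancel w v]
    exact Submodule.add_mem_sup hw1 hw2

end SingleChart

/-! ### The slice parametrization (u, y) ↦ g(u) • s(y) -/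

theorem orbitProj_smul {G M : Type*} [Group G] [TopologicalSpace M] [MulAction G M]
    {U : TopologicalSpace.Opens M} (g : G) (x y : U) (h : g • (x : M) = y) :
    orbitProj G U y = orbitProj G U x :=
  Subtype.ext <| Quotient.sound ⟨g, h⟩

theorem contMDiffAt_section_chart_symm {r q : ℕ} {G M : Type*} [Group G]
    [TopologicalSpace M] [ChartedSpace (EuclideanSpace ℝ (Fin r)) M] [MulAction G M]
    {U : TopologicalSpace.Opens M} [ChartedSpace (EuclideanSpace ℝ (Fin q)) (orbitImage G U)]
    {m₀ : U} {s : orbitImage G U → U} [IsManifold (𝓡 r) ∞ M] [IsManifold (𝓡 q) ∞ (orbitImage G U)]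
    (hs : ContMDiff (𝓡 q) (𝓡 r) ∞ s) {y : EuclideanSpace ℝ (Fin q)}
    (hy : y ∈ (chartAt (EuclideanSpace ℝ (Fin q)) (orbitProj G U m₀)).target) :
    ContMDiffAt (𝓡 q) (𝓡 r) ∞ (fun y =>
      (s ((chartAt (EuclideanSpace ℝ (Fin q)) (orbitProj G U m₀)).symm y) : M)) y := by
  have h1 : ContMDiffAt (𝓡 q) (𝓡 q) ∞
      (chartAt (EuclideanSpace ℝ (Fin q)) (orbitProj G U m₀)).symm y :=
    (contMDiffOn_chart_symm.contMDiffAt ((chartAt _ (orbitProj G U m₀)).open_target.mem_nhds hy))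
  exact (contMDiff_subtype_val.contMDiffAt (x := s _)).comp y ((hs _).comp y h1)

section Slice

variable {d r q : ℕ}
  {G : Type*} [Group G] [TopologicalSpace G]
  [ChartedSpace (EuclideanSpace ℝ (Fin d)) G]
  {M : Type*} [TopologicalSpace M]
  [ChartedSpace (EuclideanSpace ℝ (Fin r)) M]
  [MulAction G M]
  {U : TopologicalSpace.Opens M}
  [ChartedSpace (EuclideanSpace ℝ (Fin q)) (orbitImage G U)]

/-- The element of `G` with coordinates `c + L u`, where `c` are the coordinates of `1`. -/
noncomputable def groupSlice (G : Type*) [Group G] [TopologicalSpace G]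
    [ChartedSpace (EuclideanSpace ℝ (Fin d)) G] {E : Type*} [NormedAddCommGroup E] [NormedSpace ℝ E]
    (L : E →L[ℝ] EuclideanSpace ℝ (Fin d)) (u : E) : G :=
  (chartAt (EuclideanSpace ℝ (Fin d)) (1 : G)).symm
    (chartAt (EuclideanSpace ℝ (Fin d)) (1 : G) 1 + L u)

theorem groupSlice_zero {E : Type*} [NormedAddCommGroup E] [NormedSpace ℝ E]
    (L : E →L[ℝ] EuclideanSpace ℝ (Fin d)) : groupSlice G L 0 = 1 := by
  simp [groupSlice]

/-- The map `(u, y) ↦ g(u) • s(y)`, where `g(u)` runs through a slice of `G` at `1` and `y` is given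
in coordinates. -/
noncomputable def sliceParam (m₀ : U) (s : orbitImage G U → U)
    {E : Type*} [NormedAddCommGroup E] [NormedSpace ℝ E] (L : E →L[ℝ] EuclideanSpace ℝ (Fin d))
    (p : E × EuclideanSpace ℝ (Fin q)) : M :=
  groupSlice G L p.1 •
    (s ((chartAt (EuclideanSpace ℝ (Fin q)) (orbitProj G U m₀)).symm p.2) : M)

/-- The points at which the coordinates used in `sliceParam` are defined. -/
def sliceCoordDomain (m₀ : U) {E : Type*} [NormedAddCommGroup E] [NormedSpace ℝ E]
    (L : E →L[ℝ] EuclideanSpace ℝ (Fin d)) : Set (E × EuclideanSpace ℝ (Fin q)) :=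
  {p | chartAt (EuclideanSpace ℝ (Fin d)) (1 : G) 1 + L p.1 ∈
      (chartAt (EuclideanSpace ℝ (Fin d)) (1 : G)).target ∧
    p.2 ∈ (chartAt (EuclideanSpace ℝ (Fin q)) (orbitProj G U m₀)).target}

/-- The points at which `sliceParam` takes its values in the coordinate domain of `M` at `m₀` and
all constituents can be expressed in coordinates. -/
def sliceDomain (m₀ : U) (s : orbitImage G U → U)
    {E : Type*} [NormedAddCommGroup E] [NormedSpace ℝ E] (L : E →L[ℝ] EuclideanSpace ℝ (Fin d)) :
    Set (E × EuclideanSpace ℝ (Fin q)) :=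
  sliceCoordDomain (G := G) (q := q) m₀ L ∩
    (fun p => (sliceParam m₀ s L p,
        (s ((chartAt (EuclideanSpace ℝ (Fin q)) (orbitProj G U m₀)).symm p.2) : M))) ⁻¹'
      (((U : Set M) ∩ (chartAt (EuclideanSpace ℝ (Fin r)) (m₀ : M)).source) ×ˢ
        (chartAt (EuclideanSpace ℝ (Fin r)) (m₀ : M)).source)

variable {m₀ : U} {s : orbitImage G U → U}
  {E : Type} [NormedAddCommGroup E] [NormedSpace ℝ E] (L : E →L[ℝ] EuclideanSpace ℝ (Fin d))

theorem isOpen_sliceCoordDomain : IsOpen (sliceCoordDomain (G := G) (q := q) m₀ L) :=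
  ((chartAt _ (1 : G)).open_target.preimage (by fun_prop)).inter
    ((chartAt _ (orbitProj G U m₀)).open_target.preimage continuous_snd)

theorem contMDiffAt_groupSlice [IsManifold (𝓡 d) ∞ G] {u : E}
    (hu : chartAt (EuclideanSpace ℝ (Fin d)) (1 : G) 1 + L u ∈
      (chartAt (EuclideanSpace ℝ (Fin d)) (1 : G)).target) :
    ContMDiffAt 𝓘(ℝ, E) (𝓡 d) ∞ (groupSlice G L) u := by
  have h1 : ContMDiffAt (𝓡 d) (𝓡 d) ∞ (chartAt (EuclideanSpace ℝ (Fin d)) (1 : G)).symm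
      (chartAt (EuclideanSpace ℝ (Fin d)) (1 : G) 1 + L u) :=
    (contMDiffOn_chart_symm.contMDiffAt ((chartAt _ (1 : G)).open_target.mem_nhds hu))
  have h2 : ContMDiffAt 𝓘(ℝ, E) (𝓡 d) ∞
      (fun u => chartAt (EuclideanSpace ℝ (Fin d)) (1 : G) 1 + L u) u :=
    (contDiff_const.add L.contDiff).contMDiff.contMDiffAt
  exact h1.comp u h2

variable [IsManifold (𝓡 d) ∞ G] [IsManifold (𝓡 r) ∞ M] [IsManifold (𝓡 q) ∞ (orbitImage G U)]
  [ContMDiffSMul (𝓡 d) (𝓡 r) ∞ G M]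

theorem contMDiffAt_sliceParam (hs : ContMDiff (𝓡 q) (𝓡 r) ∞ s)
    {p : E × EuclideanSpace ℝ (Fin q)} (hp : p ∈ sliceCoordDomain (G := G) (q := q) m₀ L) :
    ContMDiffAt 𝓘(ℝ, E × EuclideanSpace ℝ (Fin q)) (𝓡 r) ∞ (sliceParam (q := q) m₀ s L) p := by
  have h1 : ContMDiffAt 𝓘(ℝ, E × EuclideanSpace ℝ (Fin q)) (𝓡 d) ∞
      (fun p : E × EuclideanSpace ℝ (Fin q) => groupSlice G L p.1) p :=
    (contMDiffAt_groupSlice L hp.1).comp p contDiff_fst.contMDiff.contMDiffAt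
  have h2 : ContMDiffAt 𝓘(ℝ, E × EuclideanSpace ℝ (Fin q)) (𝓡 r) ∞
      (fun p : E × EuclideanSpace ℝ (Fin q) =>
        (s ((chartAt (EuclideanSpace ℝ (Fin q)) (orbitProj G U m₀)).symm p.2) : M)) p :=
    (contMDiffAt_section_chart_symm hs hp.2).comp p contDiff_snd.contMDiff.contMDiffAt
  exact (ContMDiffSMul.contMDiff_smul (I := 𝓡 d) (I' := 𝓡 r) (n := ∞) (G := G) (M := M)
    |>.contMDiffAt).comp p (h1.prodMk h2)

theorem isOpen_sliceDomain (hs : ContMDiff (𝓡 q) (𝓡 r) ∞ s) : IsOpen (sliceDomain (r := r) (q := q) m₀ s L) := by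
  refine ContinuousOn.isOpen_inter_preimage (fun p hp => ?_) (isOpen_sliceCoordDomain L)
    ((U.isOpen.inter (chartAt _ (m₀ : M)).open_source).prod (chartAt _ (m₀ : M)).open_source)
  exact ((contMDiffAt_sliceParam L hs hp).continuousAt.prodMk
    ((contMDiffAt_section_chart_symm hs hp.2).continuousAt.comp
      continuous_snd.continuousAt)).continuousWithinAt

theorem contDiffOn_chart_comp_sliceParam (hs : ContMDiff (𝓡 q) (𝓡 r) ∞ s) :
    ContDiffOn ℝ ∞ (chartAt (EuclideanSpace ℝ (Fin r)) (m₀ : M) ∘ sliceParam (q := q) m₀ s L)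
      (sliceDomain (r := r) (q := q) m₀ s L) := by
  rw [← contMDiffOn_iff_contDiffOn]
  intro p hp
  have h1 : ContMDiffAt (𝓡 r) (𝓡 r) ∞ (chartAt (EuclideanSpace ℝ (Fin r)) (m₀ : M))
      (sliceParam (q := q) m₀ s L p) :=
    contMDiffOn_chart.contMDiffAt ((chartAt _ (m₀ : M)).open_source.mem_nhds hp.2.1.2)
  exact (h1.comp p (contMDiffAt_sliceParam L hs hp.1)).contMDiffWithinAt

end Slice

/-! ### The derivative of the parametrization at the base point -/

/-- Base points here agree only through equations such as s(π(m₀)) = m₀, so the chain rule is needed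
with a propositional equality of points. -/
theorem HasMFDerivAt.comp_of_eq {𝕜 : Type*} [NontriviallyNormedField 𝕜]
    {E : Type*} [NormedAddCommGroup E] [NormedSpace 𝕜 E] {H : Type*} [TopologicalSpace H]
    {I : ModelWithCorners 𝕜 E H} {M : Type*} [TopologicalSpace M] [ChartedSpace H M]
    {E' : Type*} [NormedAddCommGroup E'] [NormedSpace 𝕜 E'] {H' : Type*} [TopologicalSpace H']
    {I' : ModelWithCorners 𝕜 E' H'} {M' : Type*} [TopologicalSpace M'] [ChartedSpace H' M']
    {E'' : Type*} [NormedAddCommGroup E''] [NormedSpace 𝕜 E''] {H'' : Type*} [TopologicalSpace H'']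
    {I'' : ModelWithCorners 𝕜 E'' H''} {M'' : Type*} [TopologicalSpace M''] [ChartedSpace H'' M'']
    {f : M → M'} {g : M' → M''} {x : M} {y : M'} {g' : E' →L[𝕜] E''} {f' : E →L[𝕜] E'}
    (hg : HasMFDerivAt I' I'' g y g') (hf : HasMFDerivAt I I' f x f') (hy : f x = y) :
    HasMFDerivAt I I'' (g ∘ f) x (g'.comp f') := by
  subst hy
  exact HasMFDerivAt.comp x hg hf

/-- If `Im T = Ker B` with `B` surjective, the kernel of `T` has a complement parametrized by a
Euclidean space of dimension `r - q`. -/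
theorem ContinuousLinearMap.exists_complement_of_exact {d r q : ℕ}
    (T : EuclideanSpace ℝ (Fin d) →L[ℝ] EuclideanSpace ℝ (Fin r))
    (B : EuclideanSpace ℝ (Fin r) →L[ℝ] EuclideanSpace ℝ (Fin q))
    (hB : Function.Surjective B) (hTB : ∀ v, B v = 0 ↔ ∃ ξ, T ξ = v) :
    ∃ (k : ℕ) (K : Submodule ℝ (EuclideanSpace ℝ (Fin d)))
      (Q : (EuclideanSpace ℝ (Fin k) × K) ≃L[ℝ] EuclideanSpace ℝ (Fin d)),
      (∀ u, T (Q (u, 0)) = 0 → u = 0) ∧ k + q = r := by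
  -- When `T` is the derivative of the orbit map at e, `K` consists of the infinitesimal isotropy
  -- directions; the slice runs along a complement `C` of it.
  let K := LinearMap.ker T.toLinearMap
  obtain ⟨C, hC⟩ := K.exists_isCompl
  let k := Module.finrank ℝ C
  let eC : EuclideanSpace ℝ (Fin k) ≃ₗ[ℝ] C := LinearEquiv.ofFinrankEq _ _ (by simp [k])
  let Q := ((eC.prodCongr (LinearEquiv.refl ℝ K)).trans
    (Submodule.prodEquivOfIsCompl C K hC.symm)).toContinuousLinearEquiv
  refine ⟨k, K, Q, fun u hu => ?_, ?_⟩
  · have hQ : Q (u, 0) = (eC u : EuclideanSpace ℝ (Fin d)) := by simp [Q]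
    rw [hQ] at hu
    have h0 : (eC u : EuclideanSpace ℝ (Fin d)) = 0 :=
      Submodule.disjoint_def.1 hC.disjoint _ hu (eC u).2
    simpa using h0
  -- dim C = d - dim Ker T = rank T = dim Ker B = r - q, the last equality by surjectivity of `B`.
  · have hr : LinearMap.range T.toLinearMap = LinearMap.ker B.toLinearMap := by
      ext v
      exact (hTB v).symm
    have h1 := T.toLinearMap.finrank_range_add_finrank_ker
    have h2 := B.toLinearMap.finrank_range_add_finrank_ker
    have h3 := Submodule.finrank_add_eq_of_isCompl hC
    rw [LinearMap.range_eq_top.2 hB, finrank_top, ← hr] at h2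
    simp only [finrank_euclideanSpace, Fintype.card_fin] at h1 h2 h3
    change Module.finrank ℝ K + k = d at h3
    change _ + Module.finrank ℝ K = d at h1
    omega

section Slice

variable {d r q : ℕ}
  {G : Type*} [Group G] [TopologicalSpace G]
  [ChartedSpace (EuclideanSpace ℝ (Fin d)) G]
  {M : Type*} [TopologicalSpace M]
  [ChartedSpace (EuclideanSpace ℝ (Fin r)) M]
  [MulAction G M]
  {U : TopologicalSpace.Opens M}
  [ChartedSpace (EuclideanSpace ℝ (Fin q)) (orbitImage G U)]
  {m₀ : U} {s : orbitImage G U → U}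

/-- The orbit projection recovers the second argument of `sliceParam`. -/
theorem orbitProj_sliceParam {E : Type*} [NormedAddCommGroup E] [NormedSpace ℝ E]
    (L : E →L[ℝ] EuclideanSpace ℝ (Fin d))
    (hsec : ∀ y : orbitImage G U, orbitProj G U (s y) = y) {p : E × EuclideanSpace ℝ (Fin q)}
    (hp : sliceParam (q := q) m₀ s L p ∈ U) :
    orbitProj G U ⟨sliceParam (q := q) m₀ s L p, hp⟩ =
      (chartAt (EuclideanSpace ℝ (Fin q)) (orbitProj G U m₀)).symm p.2 :=
  (orbitProj_smul (groupSlice G L p.1) _ _ rfl).trans (hsec _)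

theorem sliceParam_zero {E : Type*} [NormedAddCommGroup E] [NormedSpace ℝ E]
    (L : E →L[ℝ] EuclideanSpace ℝ (Fin d)) (hsm₀ : s (orbitProj G U m₀) = m₀) :
    sliceParam (q := q) m₀ s L (0, chartAt (EuclideanSpace ℝ (Fin q)) (orbitProj G U m₀)
      (orbitProj G U m₀)) = m₀ := by
  simp [sliceParam, groupSlice_zero, hsm₀]

theorem mem_sliceDomain_zero {E : Type*} [NormedAddCommGroup E] [NormedSpace ℝ E]
    (L : E →L[ℝ] EuclideanSpace ℝ (Fin d)) (hsm₀ : s (orbitProj G U m₀) = m₀) :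
    (0, chartAt (EuclideanSpace ℝ (Fin q)) (orbitProj G U m₀) (orbitProj G U m₀)) ∈
      sliceDomain (r := r) (q := q) m₀ s L := by
  refine ⟨⟨by simp, by simp⟩, ?_⟩
  rw [Set.mem_preimage, sliceParam_zero L hsm₀]
  simp [hsm₀]

variable [IsManifold (𝓡 d) ∞ G] [IsManifold (𝓡 q) ∞ (orbitImage G U)]
  [ContMDiffSMul (𝓡 d) (𝓡 r) ∞ G M]

/-- At `m₀`, the derivative of the orbit projection in coordinates and that of the orbit map form
an exact sequence. -/
theorem exists_hasMFDerivAt_orbit_exact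
    (hπ : ContMDiff (𝓡 r) (𝓡 q) ∞ (orbitProj G U))
    (hker : ∀ v : TangentSpace (𝓡 r) m₀, mfderiv (𝓡 r) (𝓡 q) (orbitProj G U) m₀ v = 0 ↔
      ∃ ξ : TangentSpace (𝓡 d) (1 : G), mfderiv (𝓡 d) (𝓡 r) (fun g : G => g • (m₀ : M)) 1 ξ =
          mfderiv (𝓡 r) (𝓡 r) (Subtype.val : U → M) m₀ v) :
    ∃ (B : EuclideanSpace ℝ (Fin r) →L[ℝ] EuclideanSpace ℝ (Fin q))
      (T : EuclideanSpace ℝ (Fin d) →L[ℝ] EuclideanSpace ℝ (Fin r)),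
      HasMFDerivAt (𝓡 r) (𝓡 q) (chartAt (EuclideanSpace ℝ (Fin q)) (orbitProj G U m₀) ∘
        orbitProj G U ∘ U.retract m₀) (m₀ : M) B ∧
      HasMFDerivAt (𝓡 d) (𝓡 r)
        ((fun g : G => g • (m₀ : M)) ∘ (chartAt (EuclideanSpace ℝ (Fin d)) (1 : G)).symm)
        (chartAt (EuclideanSpace ℝ (Fin d)) (1 : G) 1) T ∧
      ∀ v, B v = 0 ↔ ∃ ξ, T ξ = v := by
  -- The retraction turns π|_U into a map on `M`, which can be composed with the `M`-valued
  -- `sliceParam`; only its germ at `m₀` matters.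
  have hret : HasMFDerivAt (𝓡 r) (𝓡 r) (U.retract m₀) (m₀ : M) _ :=
    ((TopologicalSpace.Opens.contMDiffAt_retract m₀ m₀.2).mdifferentiableAt (by simp)).hasMFDerivAt
  have hval : HasMFDerivAt (𝓡 r) (𝓡 r) (Subtype.val : U → M) m₀ _ :=
    ((contMDiff_subtype_val m₀).mdifferentiableAt (n := ∞) (by simp)).hasMFDerivAt
  have hπ' : HasMFDerivAt (𝓡 r) (𝓡 q) (orbitProj G U) m₀ _ :=
    ((hπ m₀).mdifferentiableAt (by simp)).hasMFDerivAt
  have hφ : OpenPartialHomeomorph.MDifferentiable (𝓡 q) (𝓡 q)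
      (chartAt (EuclideanSpace ℝ (Fin q)) (orbitProj G U m₀)) :=
    ⟨(contMDiffOn_chart (n := ∞)).mdifferentiableOn (by simp),
      (contMDiffOn_chart_symm (n := ∞)).mdifferentiableOn (by simp)⟩
  have hφ' : HasMFDerivAt (𝓡 q) (𝓡 q) (chartAt (EuclideanSpace ℝ (Fin q)) (orbitProj G U m₀))
      (orbitProj G U m₀) _ := (hφ.mdifferentiableAt (mem_chart_source _ _)).hasMFDerivAt
  have hκ : OpenPartialHomeomorph.MDifferentiable (𝓡 d) (𝓡 d)
      (chartAt (EuclideanSpace ℝ (Fin d)) (1 : G)).symm :=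
    ⟨(contMDiffOn_chart_symm (n := ∞)).mdifferentiableOn (by simp),
      (contMDiffOn_chart (n := ∞)).mdifferentiableOn (by simp)⟩
  have hκ' : HasMFDerivAt (𝓡 d) (𝓡 d) (chartAt (EuclideanSpace ℝ (Fin d)) (1 : G)).symm
      (chartAt (EuclideanSpace ℝ (Fin d)) (1 : G) 1) _ :=
    (hκ.mdifferentiableAt (mem_chart_target _ _)).hasMFDerivAt
  have hρ : HasMFDerivAt (𝓡 d) (𝓡 r) (fun g : G => g • (m₀ : M)) 1
      (mfderiv (𝓡 d) (𝓡 r) (fun g : G => g • (m₀ : M)) 1) :=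
    ((((ContMDiffSMul.contMDiff_smul (I := 𝓡 d) (I' := 𝓡 r) (n := ∞) (G := G) (M := M)).comp
      (contMDiff_id.prodMk contMDiff_const)).contMDiffAt (x := (1 : G))).mdifferentiableAt
      (by simp)).hasMFDerivAt
  have hretm : U.retract m₀ (m₀ : M) = m₀ := TopologicalSpace.Opens.retract_coe m₀ m₀
  -- The composite of retraction and inclusion is the identity near `m₀`, so the two derivatives
  -- cancel and the kernel condition can be stated in the tangent space of `M`.
  have hid : ∀ v, mfderiv (𝓡 r) (𝓡 r) (Subtype.val : U → M) m₀
      (mfderiv (𝓡 r) (𝓡 r) (U.retract m₀) (m₀ : M) v) = v := by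
    intro v
    have h1 := HasMFDerivAt.comp_of_eq hval hret hretm
    have h2 : HasMFDerivAt (𝓡 r) (𝓡 r) ((Subtype.val : U → M) ∘ U.retract m₀) (m₀ : M)
        (ContinuousLinearMap.id ℝ (EuclideanSpace ℝ (Fin r))) := by
      refine (hasMFDerivAt_id (m₀ : M)).congr_of_eventuallyEq ?_
      filter_upwards [U.isOpen.mem_nhds m₀.2] with x hx
      simp [TopologicalSpace.Opens.retract_of_mem m₀ hx]
    exact congrArg (fun A : EuclideanSpace ℝ (Fin r) →L[ℝ] EuclideanSpace ℝ (Fin r) => A v)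
      (hasMFDerivAt_unique h1 h2)
  refine ⟨_, _, HasMFDerivAt.comp_of_eq hφ' (HasMFDerivAt.comp_of_eq hπ' hret hretm)
      (congrArg (orbitProj G U) hretm),
    HasMFDerivAt.comp_of_eq hρ hκ' (by simp), fun v => ?_⟩
  -- The derivatives of the two charts are bijective, so they change neither the kernel on the left
  -- nor the image on the right.
  have hbij := hφ.mfderiv_bijective (mem_chart_source _ (orbitProj G U m₀))
  have hsurj := (hκ.mfderiv_bijective (mem_chart_target _ (1 : G))).2
  trans mfderiv (𝓡 r) (𝓡 q) (orbitProj G U) m₀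
    (mfderiv (𝓡 r) (𝓡 r) (U.retract m₀) (m₀ : M) v) = 0
  · exact map_eq_zero_iff (mfderiv (𝓡 q) (𝓡 q)
      (chartAt (EuclideanSpace ℝ (Fin q)) (orbitProj G U m₀)) (orbitProj G U m₀)) hbij.1
  · refine (hker _).trans ⟨?_, ?_⟩
    · rintro ⟨ξ, hξ⟩
      obtain ⟨η, hη⟩ := hsurj (show EuclideanSpace ℝ (Fin d) from ξ)
      have h1 : mfderiv (𝓡 d) (𝓡 r) (fun g : G => g • (m₀ : M)) 1 ξ = v := hξ.trans (hid v)
      refine ⟨η, Eq.trans ?_ h1⟩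
      exact congrArg (fun x : EuclideanSpace ℝ (Fin d) =>
        (mfderiv (𝓡 d) (𝓡 r) (fun g : G => g • (m₀ : M)) 1 :
          EuclideanSpace ℝ (Fin d) →L[ℝ] EuclideanSpace ℝ (Fin r)) x) hη
    · rintro ⟨η, hη⟩
      exact ⟨_, Eq.trans hη (hid v).symm⟩

/-- The derivative of `sliceParam` at the base point. -/
theorem exists_hasMFDerivAt_sliceParam [IsManifold (𝓡 r) ∞ M] {E : Type} [NormedAddCommGroup E] [NormedSpace ℝ E]
    (L : E →L[ℝ] EuclideanSpace ℝ (Fin d)) (hs : ContMDiff (𝓡 q) (𝓡 r) ∞ s)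
    (hsec : ∀ y : orbitImage G U, orbitProj G U (s y) = y)
    (hsm₀ : s (orbitProj G U m₀) = m₀)
    {B : EuclideanSpace ℝ (Fin r) →L[ℝ] EuclideanSpace ℝ (Fin q)}
    {T : EuclideanSpace ℝ (Fin d) →L[ℝ] EuclideanSpace ℝ (Fin r)}
    (hB : HasMFDerivAt (𝓡 r) (𝓡 q) (chartAt (EuclideanSpace ℝ (Fin q)) (orbitProj G U m₀) ∘
        orbitProj G U ∘ U.retract m₀) (m₀ : M) B)
    (hT : HasMFDerivAt (𝓡 d) (𝓡 r)
        ((fun g : G => g • (m₀ : M)) ∘ (chartAt (EuclideanSpace ℝ (Fin d)) (1 : G)).symm)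
        (chartAt (EuclideanSpace ℝ (Fin d)) (1 : G) 1) T) :
    ∃ P : E × EuclideanSpace ℝ (Fin q) →L[ℝ] EuclideanSpace ℝ (Fin r),
      HasMFDerivAt 𝓘(ℝ, E × EuclideanSpace ℝ (Fin q)) (𝓡 r) (sliceParam (q := q) m₀ s L)
        ((0 : E), chartAt (EuclideanSpace ℝ (Fin q)) (orbitProj G U m₀) (orbitProj G U m₀)) P ∧
      (∀ p, B (P p) = p.2) ∧ ∀ u, P (u, 0) = T (L u) := by
  set b := chartAt (EuclideanSpace ℝ (Fin q)) (orbitProj G U m₀) (orbitProj G U m₀) with hb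
  have hmem := mem_sliceDomain_zero (r := r) (q := q) L hsm₀
  have hP : HasMFDerivAt 𝓘(ℝ, E × EuclideanSpace ℝ (Fin q)) (𝓡 r) (sliceParam (q := q) m₀ s L)
      (0, b) _ :=
    ((contMDiffAt_sliceParam L hs hmem.1).mdifferentiableAt (by simp)).hasMFDerivAt
  refine ⟨_, hP, fun p => ?_, fun u => ?_⟩
  · have h1 := HasMFDerivAt.comp_of_eq hB hP (sliceParam_zero (q := q) L hsm₀)
    -- Acting by g(u) does not change the orbit, so near the base point π(g(u) • s(y)) = y: the
    -- composite is the second projection.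
    have h2 : HasMFDerivAt 𝓘(ℝ, E × EuclideanSpace ℝ (Fin q)) (𝓡 q)
        ((chartAt (EuclideanSpace ℝ (Fin q)) (orbitProj G U m₀) ∘ orbitProj G U ∘ U.retract m₀) ∘
          sliceParam (q := q) m₀ s L) (0, b)
        (ContinuousLinearMap.snd ℝ E (EuclideanSpace ℝ (Fin q))) := by
      refine (ContinuousLinearMap.snd ℝ E (EuclideanSpace ℝ (Fin q))).hasMFDerivAt
        |>.congr_of_eventuallyEq ?_
      filter_upwards [(isOpen_sliceDomain L hs).mem_nhds hmem] with x hx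
      simp only [Function.comp_apply, TopologicalSpace.Opens.retract_of_mem m₀ hx.2.1.1,
        orbitProj_sliceParam L hsec]
      exact (chartAt _ (orbitProj G U m₀)).right_inv hx.1.2
    exact congrArg (fun A : E × EuclideanSpace ℝ (Fin q) →L[ℝ] EuclideanSpace ℝ (Fin q) => A p)
      (hasMFDerivAt_unique h1 h2)
  · have hi : HasMFDerivAt 𝓘(ℝ, E) 𝓘(ℝ, E × EuclideanSpace ℝ (Fin q)) (fun u : E => (u, b)) 0
        (ContinuousLinearMap.inl ℝ E (EuclideanSpace ℝ (Fin q))) :=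
      (hasFDerivAt_prodMk_left (0 : E) b).hasMFDerivAt
    have h1 := HasMFDerivAt.comp_of_eq hP hi rfl
    have hL : HasMFDerivAt 𝓘(ℝ, E) (𝓡 d)
        (fun u : E => chartAt (EuclideanSpace ℝ (Fin d)) (1 : G) 1 + L u) 0 L :=
      (L.hasFDerivAt.const_add _).hasMFDerivAt
    have h2 := HasMFDerivAt.comp_of_eq hT hL (by simp)
    -- Along y = π(m₀) the section has the value `m₀`, and the parametrization is the orbit map of
    -- `m₀` restricted to the slice.
    have heq : (sliceParam (q := q) m₀ s L ∘ fun u : E => (u, b)) =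
        ((fun g : G => g • (m₀ : M)) ∘ (chartAt (EuclideanSpace ℝ (Fin d)) (1 : G)).symm) ∘
          (fun u : E => chartAt (EuclideanSpace ℝ (Fin d)) (1 : G) 1 + L u) := by
      funext u
      simp [sliceParam, groupSlice, hb, hsm₀]
    rw [heq] at h1
    exact congrArg (fun A : E →L[ℝ] EuclideanSpace ℝ (Fin r) => A u) (hasMFDerivAt_unique h1 h2)

end Slice

/-! ### Slice charts -/

section Slice

variable {d r q : ℕ}
  {G : Type*} [Group G] [TopologicalSpace G]
  [ChartedSpace (EuclideanSpace ℝ (Fin d)) G]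
  {M : Type*} [TopologicalSpace M]
  [ChartedSpace (EuclideanSpace ℝ (Fin r)) M]
  [MulAction G M]
  {U : TopologicalSpace.Opens M}
  [ChartedSpace (EuclideanSpace ℝ (Fin q)) (orbitImage G U)]
  {m₀ : U} {s : orbitImage G U → U}

/-- A smooth chart of `M` at `m₀`, defined on a ball, whose inverse is `sliceParam`. -/
structure SliceChart (d r q : ℕ)
    {G : Type*} [Group G] [TopologicalSpace G] [ChartedSpace (EuclideanSpace ℝ (Fin d)) G]
    {M : Type*} [TopologicalSpace M] [ChartedSpace (EuclideanSpace ℝ (Fin r)) M] [MulAction G M]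
    {U : TopologicalSpace.Opens M} [ChartedSpace (EuclideanSpace ℝ (Fin q)) (orbitImage G U)]
    (m₀ : U) (s : orbitImage G U → U)
    {E : Type} [NormedAddCommGroup E] [NormedSpace ℝ E] (L : E →L[ℝ] EuclideanSpace ℝ (Fin d)) where
  chart : OpenPartialHomeomorph M (E × EuclideanSpace ℝ (Fin q))
  radius : ℝ
  radius_pos : 0 < radius
  target_eq : chart.target = Metric.ball
    ((0 : E), chartAt (EuclideanSpace ℝ (Fin q)) (orbitProj G U m₀) (orbitProj G U m₀)) radius
  target_subset : chart.target ⊆ sliceDomain (r := r) (q := q) m₀ s L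
  symm_apply : ∀ p ∈ chart.target, chart.symm p = sliceParam (q := q) m₀ s L p
  contMDiffOn : ContMDiffOn (𝓡 r) 𝓘(ℝ, E × EuclideanSpace ℝ (Fin q)) ∞ chart chart.source
  contMDiffOn_symm :
    ContMDiffOn 𝓘(ℝ, E × EuclideanSpace ℝ (Fin q)) (𝓡 r) ∞ chart.symm chart.target

/-- The inverse function theorem provides slice charts. -/
theorem exists_sliceChart [IsManifold (𝓡 d) ∞ G] [IsManifold (𝓡 r) ∞ M]
    [IsManifold (𝓡 q) ∞ (orbitImage G U)] [ContMDiffSMul (𝓡 d) (𝓡 r) ∞ G M]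
    (hs : ContMDiff (𝓡 q) (𝓡 r) ∞ s)
    (hsec : ∀ y : orbitImage G U, orbitProj G U (s y) = y)
    (hsm₀ : s (orbitProj G U m₀) = m₀)
    (hπ : ContMDiff (𝓡 r) (𝓡 q) ∞ (orbitProj G U))
    (hker : ∀ v : TangentSpace (𝓡 r) m₀, mfderiv (𝓡 r) (𝓡 q) (orbitProj G U) m₀ v = 0 ↔
      ∃ ξ : TangentSpace (𝓡 d) (1 : G), mfderiv (𝓡 d) (𝓡 r) (fun g : G => g • (m₀ : M)) 1 ξ =
          mfderiv (𝓡 r) (𝓡 r) (Subtype.val : U → M) m₀ v) :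
    ∃ (k : ℕ) (K : Submodule ℝ (EuclideanSpace ℝ (Fin d)))
      (Q : (EuclideanSpace ℝ (Fin k) × K) ≃L[ℝ] EuclideanSpace ℝ (Fin d)),
      k + q = r ∧ Nonempty (SliceChart d r q m₀ s
        (Q.toContinuousLinearMap.comp (ContinuousLinearMap.inl ℝ (EuclideanSpace ℝ (Fin k)) K))) := by
  obtain ⟨B, T, hB, hT, hTB⟩ := exists_hasMFDerivAt_orbit_exact hπ hker
  have hBsurj : Function.Surjective B := by
    -- With the zero map as slice, the parametrization reduces to the section, whose derivative is a
    -- right inverse of `B`; the space `ℝ` is an arbitrary choice.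
    obtain ⟨P, -, hP, -⟩ := exists_hasMFDerivAt_sliceParam (E := ℝ) 0 hs hsec hsm₀ hB hT
    exact fun y => ⟨P (0, y), hP _⟩
  obtain ⟨k, K, Q, hQ, hk⟩ := T.exists_complement_of_exact B hBsurj hTB
  refine ⟨k, K, Q, hk, ?_⟩
  set L := Q.toContinuousLinearMap.comp
    (ContinuousLinearMap.inl ℝ (EuclideanSpace ℝ (Fin k)) K) with hL
  obtain ⟨P, hP, hP2, hP1⟩ := exists_hasMFDerivAt_sliceParam L hs hsec hsm₀ hB hT
  set φ := chartAt (EuclideanSpace ℝ (Fin r)) (m₀ : M) with hφdef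
  have hφ : OpenPartialHomeomorph.MDifferentiable (𝓡 r) (𝓡 r) φ :=
    ⟨(contMDiffOn_chart (n := ∞)).mdifferentiableOn (by simp),
      (contMDiffOn_chart_symm (n := ∞)).mdifferentiableOn (by simp)⟩
  have hmem := mem_sliceDomain_zero (r := r) (q := q) L hsm₀
  set A : EuclideanSpace ℝ (Fin k) × EuclideanSpace ℝ (Fin q) →L[ℝ] EuclideanSpace ℝ (Fin r) :=
    ContinuousLinearMap.comp (mfderiv (𝓡 r) (𝓡 r) φ (m₀ : M) :
      EuclideanSpace ℝ (Fin r) →L[ℝ] EuclideanSpace ℝ (Fin r)) P with hA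
  have hf : HasFDerivAt (φ ∘ sliceParam (q := q) m₀ s L) A
      (0, chartAt (EuclideanSpace ℝ (Fin q)) (orbitProj G U m₀) (orbitProj G U m₀)) :=
    (HasMFDerivAt.comp_of_eq
      (hφ.mdifferentiableAt (mem_chart_source _ (m₀ : M))).hasMFDerivAt hP
      (sliceParam_zero (q := q) L hsm₀)).hasFDerivAt
  have hAinj : Function.Injective A := by
    rw [injective_iff_map_eq_zero]
    rintro ⟨u, w⟩ h
    -- Applying `B` to P(u, w) = 0 yields w = 0; what remains is T(Q(u, 0)) = 0, and the slice is
    -- transverse to Ker T.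
    have h0 : P (u, w) = 0 :=
      (hφ.mfderiv_bijective (mem_chart_source _ (m₀ : M))).1 (Eq.trans h (map_zero _).symm)
    have hw : w = 0 := (hP2 (u, w)).symm.trans (by rw [h0, map_zero])
    subst hw
    rw [hP1] at h0
    rw [hQ u h0]
    rfl
  have hfin : Module.finrank ℝ (EuclideanSpace ℝ (Fin k) × EuclideanSpace ℝ (Fin q)) =
      Module.finrank ℝ (EuclideanSpace ℝ (Fin r)) := by simp [hk]
  let A' := (LinearEquiv.ofInjectiveOfFinrankEq A.toLinearMap hAinj hfin).toContinuousLinearEquiv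
  have hA' : (A' : EuclideanSpace ℝ (Fin k) × EuclideanSpace ℝ (Fin q) →L[ℝ]
      EuclideanSpace ℝ (Fin r)) = A :=
    ContinuousLinearMap.ext fun _ => rfl
  have hfs := contDiffOn_chart_comp_sliceParam (m₀ := m₀) L hs
  obtain ⟨Φ, ε, hε, hΦ, hsource, hball, hsymm⟩ :=
    hfs.exists_openPartialHomeomorph_ball (isOpen_sliceDomain L hs) hmem
      ⟨A', hf.fderiv.trans hA'.symm⟩
  -- Nothing is lost in the composition: on `sliceDomain` the values of `sliceParam` lie in the
  -- source of `φ`, so all of `Φ.target` lies in `φ.target`.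
  have htarget : (φ.trans Φ.symm).target = Φ.source := by
    rw [OpenPartialHomeomorph.trans_target]
    refine Set.inter_eq_left.2 fun p (hp : p ∈ Φ.source) => ?_
    have hp' := hball (hsource ▸ hp)
    change Φ p ∈ φ.target
    rw [hΦ]
    exact φ.map_source hp'.2.1.2
  have hsymm' : ∀ p ∈ Φ.source, (φ.trans Φ.symm).symm p = sliceParam (q := q) m₀ s L p := by
    intro p hp
    have hp' := hball (hsource ▸ hp)
    change φ.symm (Φ p) = _
    rw [hΦ]
    exact φ.left_inv hp'.2.1.2
  exact ⟨{
    chart := φ.trans Φ.symm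
    radius := ε
    radius_pos := hε
    target_eq := htarget.trans hsource
    target_subset := (htarget.trans hsource).subset.trans hball
    symm_apply := fun p hp => hsymm' p (htarget ▸ hp)
    contMDiffOn := by
      refine hsymm.contMDiffOn.comp (contMDiffOn_chart.mono fun x hx => hx.1) fun x hx => hx.2
    contMDiffOn_symm := by
      rw [htarget]
      refine ContMDiffOn.congr (fun p hp => ?_) hsymm'
      exact (contMDiffAt_sliceParam L hs (hball (hsource ▸ hp)).1).contMDiffWithinAt }⟩

namespace SliceChart

variable {E : Type} [NormedAddCommGroup E] [NormedSpace ℝ E]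
  {L : E →L[ℝ] EuclideanSpace ℝ (Fin d)} (σ : SliceChart d r q m₀ s L)

/-- The domain of a slice chart. -/
def domain : TopologicalSpace.Opens M := ⟨σ.chart.source, σ.chart.open_source⟩

theorem base_mem_target : ((0 : E), chartAt (EuclideanSpace ℝ (Fin q)) (orbitProj G U m₀)
    (orbitProj G U m₀)) ∈ σ.chart.target :=
  σ.target_eq ▸ Metric.mem_ball_self σ.radius_pos

/-- The norm on a product is the max norm. The product shape allows u and y to vary independently,
in particular u to be replaced by 0 and y by its base value. -/
theorem target_eq_prod : σ.chart.target = Metric.ball (0 : E) σ.radius ×ˢ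
    Metric.ball (chartAt (EuclideanSpace ℝ (Fin q)) (orbitProj G U m₀) (orbitProj G U m₀))
      σ.radius := by
  rw [σ.target_eq, ball_prod_same]

theorem domain_subset (m : M) (hm : m ∈ σ.domain) :
    m ∈ U ∧ m ∈ (chartAt (EuclideanSpace ℝ (Fin r)) (m₀ : M)).source := by
  have hp := σ.chart.map_source hm
  have h := (σ.target_subset hp).2.1
  change sliceParam (q := q) m₀ s L (σ.chart m) ∈ _ at h
  rwa [← σ.symm_apply _ hp, σ.chart.left_inv hm] at h

theorem domain_le : σ.domain ≤ U := fun m hm => (σ.domain_subset m hm).1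

theorem base_mem (hsm₀ : s (orbitProj G U m₀) = m₀) : (m₀ : M) ∈ σ.domain := by
  have h := σ.chart.map_target σ.base_mem_target
  rwa [σ.symm_apply _ σ.base_mem_target, sliceParam_zero L hsm₀] at h

theorem chart_base (hsm₀ : s (orbitProj G U m₀) = m₀) : σ.chart m₀ =
    ((0 : E), chartAt (EuclideanSpace ℝ (Fin q)) (orbitProj G U m₀) (orbitProj G U m₀)) := by
  have h := σ.chart.right_inv σ.base_mem_target
  rwa [σ.symm_apply _ σ.base_mem_target, sliceParam_zero L hsm₀] at h

theorem isConnected_domain : IsConnected (σ.domain : Set M) := by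
  have h := σ.chart.symm_image_target_eq_source
  change IsConnected σ.chart.source
  rw [← h]
  refine IsConnected.image ?_ _ σ.chart.continuousOn_symm
  rw [σ.target_eq]
  exact Metric.isConnected_ball σ.radius_pos

/-- A point with slice coordinates (u, y) is g(u) • s(y), hence lies on the orbit y: in a slice
chart π is the second projection. -/
theorem orbitProj_eq (hsec : ∀ y : orbitImage G U, orbitProj G U (s y) = y) (m : σ.domain) :
    orbitProj G U ⟨m, σ.domain_le m.2⟩ =
      (chartAt (EuclideanSpace ℝ (Fin q)) (orbitProj G U m₀)).symm (σ.chart m).2 := by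
  have hp := σ.chart.map_source m.2
  have h := σ.symm_apply _ hp
  rw [σ.chart.left_inv m.2] at h
  rw [← orbitProj_sliceParam L hsec (p := σ.chart m) (h ▸ σ.domain_le m.2)]
  congr 1
  exact Subtype.ext h

theorem chart_orbitProj (hsec : ∀ y : orbitImage G U, orbitProj G U (s y) = y) (m : σ.domain) :
    chartAt (EuclideanSpace ℝ (Fin q)) (orbitProj G U m₀) (orbitProj G U ⟨m, σ.domain_le m.2⟩) =
      (σ.chart m).2 := by
  rw [σ.orbitProj_eq hsec]
  exact (chartAt _ (orbitProj G U m₀)).right_inv (σ.target_subset (σ.chart.map_source m.2)).1.2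

/-- Since g(0) = e, the point s(y) has slice coordinates (0, y), and (0, y) belongs to the product
of balls along with (u, y). This is what gives s(π(V)) ⊆ V. -/
theorem section_mem {p : E × EuclideanSpace ℝ (Fin q)} (hp : p ∈ σ.chart.target) :
    (s ((chartAt (EuclideanSpace ℝ (Fin q)) (orbitProj G U m₀)).symm p.2) : M) ∈ σ.domain := by
  have hp' : ((0 : E), p.2) ∈ σ.chart.target := by
    rw [σ.target_eq_prod] at hp ⊢
    exact ⟨Metric.mem_ball_self σ.radius_pos, hp.2⟩
  have h := σ.chart.map_target hp'
  rw [σ.symm_apply _ hp'] at h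
  simp only [sliceParam, groupSlice_zero, one_smul] at h
  exact h

/-- The image `π(V)` of the domain `V` of a slice chart is open in `π(U)`. -/
theorem isOpenEmbedding_inclusion (hsec : ∀ y : orbitImage G U, orbitProj G U (s y) = y) :
    Topology.IsOpenEmbedding (Set.inclusion (orbitImage_mono G σ.domain_le)) := by
  refine ⟨Topology.IsEmbedding.inclusion _, ?_⟩
  -- π(V) is a full ball in the chart of π(U) at π(m₀): y-coordinates of points of V lie in the
  -- ball, and conversely each such y is the orbit of s(y), a point of V.
  have h : Set.range (Set.inclusion (orbitImage_mono G σ.domain_le)) =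
      (chartAt (EuclideanSpace ℝ (Fin q)) (orbitProj G U m₀)).source ∩
        chartAt (EuclideanSpace ℝ (Fin q)) (orbitProj G U m₀) ⁻¹'
          Metric.ball (chartAt (EuclideanSpace ℝ (Fin q)) (orbitProj G U m₀) (orbitProj G U m₀))
            σ.radius := by
    ext y
    constructor
    · rintro ⟨⟨_, m, hm, rfl⟩, rfl⟩
      have hp := σ.chart.map_source hm
      have h1 := σ.orbitProj_eq hsec ⟨m, hm⟩
      have h2 := σ.chart_orbitProj hsec ⟨m, hm⟩
      change orbitProj G U ⟨m, σ.domain_le hm⟩ ∈ _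
      refine ⟨?_, ?_⟩
      · rw [h1]
        exact (chartAt _ (orbitProj G U m₀)).map_target (σ.target_subset hp).1.2
      · rw [Set.mem_preimage, h2]
        rw [σ.target_eq_prod] at hp
        exact hp.2
    · rintro ⟨hy, hy'⟩
      have hp : ((0 : E), chartAt (EuclideanSpace ℝ (Fin q)) (orbitProj G U m₀) y) ∈
          σ.chart.target := by
        rw [σ.target_eq_prod]
        exact ⟨Metric.mem_ball_self σ.radius_pos, hy'⟩
      have hm := σ.section_mem hp
      simp only [(chartAt _ (orbitProj G U m₀)).left_inv hy] at hm
      refine ⟨orbitProj G σ.domain ⟨s y, hm⟩, Subtype.ext ?_⟩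
      exact congrArg Subtype.val (hsec y)
  rw [h]
  exact (chartAt _ (orbitProj G U m₀)).isOpen_inter_preimage Metric.isOpen_ball

end SliceChart

end Slice

/-! ### Global charts of V and π(V) -/

theorem OpenPartialHomeomorph.isSmoothManifold_singleton {n : ℕ} {X : Type*} [TopologicalSpace X]
    [T2Space X] [SecondCountableTopology X]
    (e : OpenPartialHomeomorph X (EuclideanSpace ℝ (Fin n))) (h : e.source = Set.univ) :
    @IsSmoothManifold n X _ (e.singletonChartedSpace h) :=
  letI := e.singletonChartedSpace h
  ⟨inferInstance, inferInstance, e.isManifold_singleton h⟩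

theorem OpenPartialHomeomorph.mem_maximalAtlas_singleton {n : ℕ} {X : Type*} [TopologicalSpace X]
    (e : OpenPartialHomeomorph X (EuclideanSpace ℝ (Fin n))) (h : e.source = Set.univ) :
    letI := e.singletonChartedSpace h
    e ∈ IsManifold.maximalAtlas (𝓡 n) ∞ X :=
  letI := e.singletonChartedSpace h
  haveI : IsManifold (𝓡 n) ∞ X := e.isManifold_singleton h
  IsManifold.subset_maximalAtlas rfl

namespace SliceChart

variable {d r q : ℕ}
  {G : Type*} [Group G] [TopologicalSpace G]
  [ChartedSpace (EuclideanSpace ℝ (Fin d)) G]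
  {M : Type*} [TopologicalSpace M]
  [ChartedSpace (EuclideanSpace ℝ (Fin r)) M]
  [MulAction G M]
  {U : TopologicalSpace.Opens M}
  [ChartedSpace (EuclideanSpace ℝ (Fin q)) (orbitImage G U)]
  {m₀ : U} {s : orbitImage G U → U}

section Domain

variable {E : Type} [NormedAddCommGroup E] [NormedSpace ℝ E]
  {L : E →L[ℝ] EuclideanSpace ℝ (Fin d)} (σ : SliceChart d r q m₀ s L)

theorem nonempty_domain : Nonempty σ.domain :=
  ⟨⟨σ.chart.symm _, σ.chart.map_target σ.base_mem_target⟩⟩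

/-- A slice chart as a global chart of its domain. -/
noncomputable def domainChart : OpenPartialHomeomorph σ.domain (E × EuclideanSpace ℝ (Fin q)) :=
  σ.chart.subtypeRestr σ.nonempty_domain

theorem domainChart_source : σ.domainChart.source = Set.univ :=
  Set.eq_univ_of_forall fun m => by
    rw [domainChart, OpenPartialHomeomorph.subtypeRestr_source]
    exact m.2

theorem domainChart_target : σ.domainChart.target = σ.chart.target := by
  refine (σ.chart.subtypeRestr_target_subset _).antisymm fun p hp => ?_
  have h := σ.chart.map_subtype_source (s := σ.domain) σ.nonempty_domain
    (x := ⟨σ.chart.symm p, σ.chart.map_target hp⟩) (σ.chart.map_target hp)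
  change σ.chart (σ.chart.symm p) ∈ _ at h
  rwa [σ.chart.right_inv hp] at h

theorem coe_domainChart_symm {p : E × EuclideanSpace ℝ (Fin q)} (hp : p ∈ σ.chart.target) :
    (σ.domainChart.symm p : M) = σ.chart.symm p :=
  σ.chart.subtypeRestr_symm_apply _ (σ.domainChart_target.symm ▸ hp)

/-- The slice chart, with values in a Euclidean space. -/
noncomputable def euclideanChart (T : EuclideanSpace ℝ (Fin r) ≃L[ℝ] E × EuclideanSpace ℝ (Fin q)) :
    OpenPartialHomeomorph σ.domain (EuclideanSpace ℝ (Fin r)) :=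
  σ.domainChart.trans T.symm.toHomeomorph.toOpenPartialHomeomorph

theorem euclideanChart_apply (T : EuclideanSpace ℝ (Fin r) ≃L[ℝ] E × EuclideanSpace ℝ (Fin q))
    (m : σ.domain) : T (σ.euclideanChart T m) = σ.chart m :=
  T.apply_symm_apply _

theorem euclideanChart_source
    (T : EuclideanSpace ℝ (Fin r) ≃L[ℝ] E × EuclideanSpace ℝ (Fin q)) :
    (σ.euclideanChart T).source = Set.univ := by
  simp [euclideanChart, domainChart_source]

theorem euclideanChart_mem_maximalAtlas [IsManifold (𝓡 r) ∞ M]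
    (T : EuclideanSpace ℝ (Fin r) ≃L[ℝ] E × EuclideanSpace ℝ (Fin q)) :
    σ.euclideanChart T ∈ IsManifold.maximalAtlas (𝓡 r) ∞ σ.domain := by
  refine OpenPartialHomeomorph.mem_maximalAtlas_of_contMDiffOn _ ?_ ?_
  · have h1 : ContMDiff (𝓡 r) 𝓘(ℝ, E × EuclideanSpace ℝ (Fin q)) ∞
        (σ.chart ∘ (Subtype.val : σ.domain → M)) :=
      σ.contMDiffOn.comp_contMDiff contMDiff_subtype_val fun m => m.2
    exact (T.symm.contDiff.contMDiff.comp h1).contMDiffOn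
  · intro z hz
    have hz' : T z ∈ σ.chart.target := by
      rw [← σ.domainChart_target]
      exact hz.2
    -- Smoothness into the open subset V is tested after inclusion into M, where the inverse chart
    -- is `σ.chart.symm ∘ T`.
    rw [← ContMDiffWithinAt.subtypeVal_comp_iff]
    have h1 : ContMDiffAt (𝓡 r) (𝓡 r) ∞ (σ.chart.symm ∘ T) z :=
      ((σ.contMDiffOn_symm.contMDiffAt (σ.chart.open_target.mem_nhds hz')).comp z
        T.contDiff.contMDiff.contMDiffAt)
    refine h1.contMDiffWithinAt.congr (fun y hy => ?_) (σ.coe_domainChart_symm hz')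
    refine σ.coe_domainChart_symm ?_
    rw [← σ.domainChart_target]
    exact hy.2

/-- The global chart of `π(V)` induced by the chart of `π(U)` at `π(m₀)`. -/
noncomputable def orbitChart (hsec : ∀ y : orbitImage G U, orbitProj G U (s y) = y) :
    OpenPartialHomeomorph (orbitImage G σ.domain) (EuclideanSpace ℝ (Fin q)) :=
  haveI : Nonempty (orbitImage G σ.domain) := σ.nonempty_domain.map (orbitProj G σ.domain)
  ((σ.isOpenEmbedding_inclusion hsec).toOpenPartialHomeomorph _).trans
    (chartAt (EuclideanSpace ℝ (Fin q)) (orbitProj G U m₀))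

variable (hsec : ∀ y : orbitImage G U, orbitProj G U (s y) = y)

theorem inclusion_mem_source (hsec : ∀ y : orbitImage G U, orbitProj G U (s y) = y) (y : orbitImage G σ.domain) :
    Set.inclusion (orbitImage_mono G σ.domain_le) y ∈
      (chartAt (EuclideanSpace ℝ (Fin q)) (orbitProj G U m₀)).source := by
  obtain ⟨_, m, hm, rfl⟩ := y
  change orbitProj G U ⟨m, σ.domain_le hm⟩ ∈ _
  rw [σ.orbitProj_eq hsec ⟨m, hm⟩]
  exact (chartAt _ (orbitProj G U m₀)).map_target (σ.target_subset (σ.chart.map_source hm)).1.2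

theorem orbitChart_source : (σ.orbitChart hsec).source = Set.univ := by
  refine Set.eq_univ_of_forall fun y => ?_
  simpa [orbitChart] using σ.inclusion_mem_source hsec y

theorem orbitChart_orbitProj (m : σ.domain) :
    σ.orbitChart hsec (orbitProj G σ.domain m) = (σ.chart m).2 :=
  σ.chart_orbitProj hsec m

/-- The chart of π(V) is the restriction of the chart of π(U), so in these charts the inclusion and
its inverse are identities. -/
theorem isLocalDiffeomorph_inclusion [IsManifold (𝓡 q) ∞ (orbitImage G U)] :
    letI := (σ.orbitChart hsec).singletonChartedSpace (σ.orbitChart_source hsec)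
    IsLocalDiffeomorph (𝓡 q) (𝓡 q) ∞ (Set.inclusion (orbitImage_mono G σ.domain_le)) := by
  let := (σ.orbitChart hsec).singletonChartedSpace (σ.orbitChart_source hsec)
  have : IsManifold (𝓡 q) ∞ (orbitImage G σ.domain) :=
    (σ.orbitChart hsec).isManifold_singleton (σ.orbitChart_source hsec)
  have : Nonempty (orbitImage G σ.domain) := σ.nonempty_domain.map (orbitProj G σ.domain)
  have hatlas := (σ.orbitChart hsec).mem_maximalAtlas_singleton (σ.orbitChart_source hsec)
  set j := Set.inclusion (orbitImage_mono G σ.domain_le) with hj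
  let Φ := (σ.isOpenEmbedding_inclusion hsec).toOpenPartialHomeomorph _
  have hsource : Φ.source = Set.univ := by simp [Φ]
  have hleft : ∀ y, Φ.symm (j y) = y := fun y => Φ.left_inv (by simp [hsource])
  have h1 : ContMDiff (𝓡 q) (𝓡 q) ∞ j := by
    have h2 : ContMDiffOn (𝓡 q) (𝓡 q) ∞
        ((chartAt (EuclideanSpace ℝ (Fin q)) (orbitProj G U m₀)).symm ∘ σ.orbitChart hsec)
          (σ.orbitChart hsec).source :=
      contMDiffOn_chart_symm.comp (contMDiffOn_of_mem_maximalAtlas hatlas)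
        fun y _ => (chartAt _ (orbitProj G U m₀)).map_source (σ.inclusion_mem_source hsec y)
    rw [orbitChart_source, contMDiffOn_univ] at h2
    refine h2.congr fun y => ?_
    exact ((chartAt _ (orbitProj G U m₀)).left_inv (σ.inclusion_mem_source hsec y)).symm
  have h3 : ContMDiffOn (𝓡 q) (𝓡 q) ∞ Φ.symm Φ.target := by
    have htarget : ∀ y ∈ Φ.target, y = j (Φ.symm y) := fun y hy => (Φ.right_inv hy).symm
    have h2 : ContMDiffOn (𝓡 q) (𝓡 q) ∞ ((σ.orbitChart hsec).symm ∘
        chartAt (EuclideanSpace ℝ (Fin q)) (orbitProj G U m₀)) Φ.target := by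
      refine (contMDiffOn_symm_of_mem_maximalAtlas hatlas).comp
        (contMDiffOn_chart.mono fun y hy => ?_) fun y hy => ?_
      · rw [htarget y hy]
        exact σ.inclusion_mem_source hsec _
      · rw [Set.mem_preimage, htarget y hy]
        exact (σ.orbitChart hsec).map_source (by simp [orbitChart_source])
    refine h2.congr fun y hy => ?_
    rw [Function.comp_apply, htarget y hy, hleft]
    exact ((σ.orbitChart hsec).left_inv (by simp [orbitChart_source])).symm
  intro y
  exact ⟨{ Φ.toPartialEquiv with
    open_source := Φ.open_source
    open_target := Φ.open_target
    contMDiffOn_toFun := h1.contMDiffOn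
    contMDiffOn_invFun := h3 }, by simp [hsource], fun _ _ => rfl⟩

end Domain

/-! ### The map Θ and its image -/

section Theta

variable {k : ℕ} {F : Type} [NormedAddCommGroup F] [NormedSpace ℝ F]
  {Q : (EuclideanSpace ℝ (Fin k) × F) ≃L[ℝ] EuclideanSpace ℝ (Fin d)}
  (σ : SliceChart d r q m₀ s (Q.toContinuousLinearMap.comp
    (ContinuousLinearMap.inl ℝ (EuclideanSpace ℝ (Fin k)) F)))

/-- The map `Θ`: the group component of the inverse of `sliceParam`. -/
noncomputable def theta (m : σ.domain) : G :=
  groupSlice G (Q.toContinuousLinearMap.comp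
    (ContinuousLinearMap.inl ℝ (EuclideanSpace ℝ (Fin k)) F)) (σ.chart m).1

theorem theta_mem_source (m : σ.domain) :
    σ.theta m ∈ (chartAt (EuclideanSpace ℝ (Fin d)) (1 : G)).source :=
  (chartAt _ (1 : G)).map_target (σ.target_subset (σ.chart.map_source m.2)).1.1

theorem chart_theta (m : σ.domain) : chartAt (EuclideanSpace ℝ (Fin d)) (1 : G) (σ.theta m) =
    chartAt (EuclideanSpace ℝ (Fin d)) (1 : G) 1 + Q ((σ.chart m).1, 0) :=
  (chartAt _ (1 : G)).right_inv (σ.target_subset (σ.chart.map_source m.2)).1.1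

theorem theta_base (hsm₀ : s (orbitProj G U m₀) = m₀) (h : (m₀ : M) ∈ σ.domain) :
    σ.theta ⟨m₀, h⟩ = 1 := by
  simp only [theta, σ.chart_base hsm₀, groupSlice_zero]

/-- This is the equation σ.chart.symm (σ.chart m) = m, with the inverse chart written as g(u) •
s(y). -/
theorem theta_smul (hsec : ∀ y : orbitImage G U, orbitProj G U (s y) = y) (m : σ.domain) :
    σ.theta m • (s (orbitProj G U ⟨m, σ.domain_le m.2⟩) : M) = m := by
  rw [σ.orbitProj_eq hsec]
  have hp := σ.chart.map_source m.2
  have h := σ.symm_apply _ hp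
  rw [σ.chart.left_inv m.2] at h
  exact h.symm

theorem domainChart_symm_base {u : EuclideanSpace ℝ (Fin k)}
    (hu : u ∈ Metric.ball (0 : EuclideanSpace ℝ (Fin k)) σ.radius) :
    (u, chartAt (EuclideanSpace ℝ (Fin q)) (orbitProj G U m₀) (orbitProj G U m₀)) ∈
      σ.chart.target := by
  rw [σ.target_eq_prod]
  exact ⟨hu, Metric.mem_ball_self σ.radius_pos⟩

theorem fst_mem_ball (m : σ.domain) :
    (σ.chart m).1 ∈ Metric.ball (0 : EuclideanSpace ℝ (Fin k)) σ.radius := by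
  have hp := σ.chart.map_source m.2
  rw [σ.target_eq_prod] at hp
  exact hp.1

theorem chart_domainChart_symm {p : EuclideanSpace ℝ (Fin k) × EuclideanSpace ℝ (Fin q)}
    (hp : p ∈ σ.chart.target) : σ.chart (σ.domainChart.symm p : M) = p := by
  rw [σ.coe_domainChart_symm hp, σ.chart.right_inv hp]

theorem fst_chart_domainChart_symm {u : EuclideanSpace ℝ (Fin k)}
    (hu : u ∈ Metric.ball (0 : EuclideanSpace ℝ (Fin k)) σ.radius) :
    (σ.chart (σ.domainChart.symm
      (u, chartAt (EuclideanSpace ℝ (Fin q)) (orbitProj G U m₀) (orbitProj G U m₀)) : M)).1 = u := by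
  rw [σ.chart_domainChart_symm (σ.domainChart_symm_base hu)]

/-- The global chart of `Θ(V)` whose inverse is the slice of `G`. -/
noncomputable def thetaChart :
    OpenPartialHomeomorph (Set.range σ.theta) (EuclideanSpace ℝ (Fin k)) where
  toFun g := (Q.symm (chartAt (EuclideanSpace ℝ (Fin d)) (1 : G) (g : G) -
    chartAt (EuclideanSpace ℝ (Fin d)) (1 : G) 1)).1
  -- Θ depends only on u, so any point of V with first coordinate u would serve; the one with the
  -- y-coordinate of π(m₀) is taken.
  invFun u := Set.rangeFactorization σ.theta (σ.domainChart.symm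
    (u, chartAt (EuclideanSpace ℝ (Fin q)) (orbitProj G U m₀) (orbitProj G U m₀)))
  source := Set.univ
  target := Metric.ball 0 σ.radius
  map_source' := by
    rintro ⟨_, m, rfl⟩ _
    simpa [chart_theta] using σ.fst_mem_ball m
  map_target' _ _ := Set.mem_univ _
  left_inv' := by
    rintro ⟨_, m, rfl⟩ _
    apply Subtype.ext
    simp only [chart_theta, add_sub_cancel_left, ContinuousLinearEquiv.symm_apply_apply,
      Set.rangeFactorization_coe]
    exact congrArg (groupSlice G (Q.toContinuousLinearMap.comp
        (ContinuousLinearMap.inl ℝ (EuclideanSpace ℝ (Fin k)) F)))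
      (σ.fst_chart_domainChart_symm (σ.fst_mem_ball m))
  right_inv' u hu := by
    simp [chart_theta, σ.fst_chart_domainChart_symm hu]
  open_source := isOpen_univ
  open_target := Metric.isOpen_ball
  continuousOn_toFun := by
    have h1 : ContinuousOn (fun g : Set.range σ.theta =>
        chartAt (EuclideanSpace ℝ (Fin d)) (1 : G) (g : G)) Set.univ := by
      refine (chartAt (EuclideanSpace ℝ (Fin d)) (1 : G)).continuousOn.comp
        continuous_subtype_val.continuousOn ?_
      rintro ⟨_, m, rfl⟩ _
      exact σ.theta_mem_source m
    exact (continuous_fst.comp Q.symm.continuous).comp_continuousOn (h1.sub continuousOn_const)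
  -- Θ(V) has the topology induced from G, so continuity is checked after inclusion, where the
  -- inverse chart is `groupSlice` itself.
  continuousOn_invFun := by
    rw [continuousOn_iff_continuous_domRestrict, Topology.IsInducing.subtypeVal.continuous_iff,
      ← continuousOn_univ]
    have h1 : ContinuousOn (groupSlice G (Q.toContinuousLinearMap.comp
        (ContinuousLinearMap.inl ℝ (EuclideanSpace ℝ (Fin k)) F)))
        (Metric.ball 0 σ.radius) := by
      refine (chartAt (EuclideanSpace ℝ (Fin d)) (1 : G)).continuousOn_symm.comp
        (by fun_prop) fun u hu => ?_
      exact (σ.target_subset (σ.domainChart_symm_base hu)).1.1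
    refine (h1.comp continuous_subtype_val.continuousOn fun u _ => u.2).congr fun u _ => ?_
    simp [theta, σ.fst_chart_domainChart_symm u.2]

theorem thetaChart_theta (m : σ.domain) :
    σ.thetaChart (Set.rangeFactorization σ.theta m) = (σ.chart m).1 := by
  change (Q.symm (chartAt (EuclideanSpace ℝ (Fin d)) (1 : G) (σ.theta m) -
    chartAt (EuclideanSpace ℝ (Fin d)) (1 : G) 1)).1 = _
  simp [chart_theta]

theorem chart_thetaChart_symm {u : EuclideanSpace ℝ (Fin k)} (hu : u ∈ σ.thetaChart.target) :
    chartAt (EuclideanSpace ℝ (Fin d)) (1 : G) (σ.thetaChart.symm u : G) =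
      chartAt (EuclideanSpace ℝ (Fin d)) (1 : G) 1 + Q (u, 0) := by
  change chartAt (EuclideanSpace ℝ (Fin d)) (1 : G) (σ.theta (σ.domainChart.symm
    (u, chartAt (EuclideanSpace ℝ (Fin q)) (orbitProj G U m₀) (orbitProj G U m₀)))) = _
  rw [chart_theta, σ.fst_chart_domainChart_symm hu]

/-- In the chart of G at e the set Θ(V) is parametrized by u ↦ c + Q(u, 0), an affine injection with
complement `F` supplied by `Q`; hence the inclusion is an immersion, and it is an embedding because
Θ(V) carries the subspace topology. -/
theorem isEmbeddedSubmanifold_range_theta [IsManifold (𝓡 d) ∞ G] [T2Space G]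
    [SecondCountableTopology G] :
    letI := σ.thetaChart.singletonChartedSpace rfl
    IsEmbeddedSubmanifold d k (Set.range σ.theta) := by
  let := σ.thetaChart.singletonChartedSpace rfl
  refine ⟨σ.thetaChart.isSmoothManifold_singleton rfl, ?_, Topology.IsEmbedding.subtypeVal⟩
  refine Manifold.IsImmersionOfComplement.isImmersion (F := F) fun g => ?_
  -- Translating the chart so that e has coordinates 0 makes the inclusion u ↦ Q(u, 0) exactly, the
  -- normal form required of an immersion.
  let τ := Homeomorph.addRight (-(chartAt (EuclideanSpace ℝ (Fin d)) (1 : G) 1))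
  let κ := (chartAt (EuclideanSpace ℝ (Fin d)) (1 : G)).trans τ.toOpenPartialHomeomorph
  have hκ : κ ∈ IsManifold.maximalAtlas (𝓡 d) ∞ G := by
    refine OpenPartialHomeomorph.mem_maximalAtlas_of_contMDiffOn _ ?_ ?_
    · have h : ContMDiff (𝓡 d) (𝓡 d) ∞ τ :=
        (contDiff_id.add contDiff_const).contMDiff
      exact h.comp_contMDiffOn (contMDiffOn_chart.mono fun x hx => hx.1)
    · have h : ContMDiff (𝓡 d) (𝓡 d) ∞ τ.symm :=
        (contDiff_id.add contDiff_const).contMDiff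
      exact contMDiffOn_chart_symm.comp h.contMDiffOn fun x hx => hx.2
  have hsource : ∀ g : Set.range σ.theta, (g : G) ∈ κ.source := by
    rintro ⟨_, m, rfl⟩
    exact ⟨σ.theta_mem_source m, trivial⟩
  refine Manifold.IsImmersionAtOfComplement.mk_of_charts Q σ.thetaChart κ (Set.mem_univ _)
    (hsource g) (σ.thetaChart.mem_maximalAtlas_singleton rfl) hκ (fun g _ => hsource g) ?_
  intro u hu
  have hu' : u ∈ σ.thetaChart.target := by simpa using hu
  have h := σ.chart_thetaChart_symm hu'
  simp [κ, τ, h]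

end Theta

end SliceChart

/-! ### Construction up to quadratures -/

namespace SliceChart

variable {d r q : ℕ}
  {G : Type*} [Group G] [TopologicalSpace G]
  [ChartedSpace (EuclideanSpace ℝ (Fin d)) G]
  {M : Type*} [TopologicalSpace M]
  [ChartedSpace (EuclideanSpace ℝ (Fin r)) M]
  [MulAction G M]
  {U : TopologicalSpace.Opens M}
  [ChartedSpace (EuclideanSpace ℝ (Fin q)) (orbitImage G U)]
  {m₀ : U} {s : orbitImage G U → U}

/-- The expression of `sliceParam` in the chart at `m₀` is obtained from those of the section and
the action. -/
theorem constructible_chart_comp_sliceParam {E : Type} [NormedAddCommGroup E] [NormedSpace ℝ E]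
    [FiniteDimensional ℝ E] (L : E →L[ℝ] EuclideanSpace ℝ (Fin d))
    (hsm₀ : s (orbitProj G U m₀) = m₀) {A : Set (E × EuclideanSpace ℝ (Fin q))} (hA : IsOpen A)
    (hAs : A ⊆ sliceDomain (r := r) (q := q) m₀ s L) :
    ConstructibleUpToQuadratures (ActionData d r q U m₀ s) (E × EuclideanSpace ℝ (Fin q))
      (EuclideanSpace ℝ (Fin r)) A
      (chartAt (EuclideanSpace ℝ (Fin r)) (m₀ : M) ∘ sliceParam (q := q) m₀ s L) := by
  have h1 : ConstructibleUpToQuadratures (ActionData d r q U m₀ s) _ _ A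
      (fun p : E × EuclideanSpace ℝ (Fin q) => chartAt (EuclideanSpace ℝ (Fin d)) (1 : G) 1 + L p.1) :=
    .restrict (.affine (L.comp (ContinuousLinearMap.fst ℝ E (EuclideanSpace ℝ (Fin q))))
      (chartAt (EuclideanSpace ℝ (Fin d)) (1 : G) 1)) hA (Set.subset_univ _)
      fun p _ => add_comm _ _
  have h2 : ConstructibleUpToQuadratures (ActionData d r q U m₀ s) _ _ A
      (fun p : E × EuclideanSpace ℝ (Fin q) => p.2) :=
    .restrict (.affine (ContinuousLinearMap.snd ℝ E (EuclideanSpace ℝ (Fin q))) 0)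
      hA (Set.subset_univ _) fun p _ => add_zero _
  have h3 : ConstructibleUpToQuadratures (ActionData d r q U m₀ s) _ _ A
      (writtenInExtChartAt (𝓡 q) (𝓡 r) (orbitProj G U m₀) s ∘ fun p => p.2) := by
    refine .comp h2 (.known .localSection) fun p hp => ?_
    have hp' := hAs hp
    refine ⟨?_, ?_⟩
    · simpa using hp'.1.2
    · simpa [hsm₀, TopologicalSpace.Opens.chartAt_eq] using hp'.2.2
  have hs : ∀ y, writtenInExtChartAt (𝓡 q) (𝓡 r) (orbitProj G U m₀) s y =
      chartAt (EuclideanSpace ℝ (Fin r)) (m₀ : M)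
        (s ((chartAt (EuclideanSpace ℝ (Fin q)) (orbitProj G U m₀)).symm y)) := fun y => by
    simp [writtenInExtChartAt, hsm₀, TopologicalSpace.Opens.chartAt_eq]
  refine .restrict (.comp (.pair h1 h3) (.known .action) fun p hp => ?_) hA subset_rfl
    fun p hp => ?_
  · obtain ⟨⟨hp1, -⟩, ⟨-, hp4⟩, hp5⟩ := hAs hp
    -- The coordinate expression of s feeds into that of ρ only if s(y) itself, and not just g(u) •
    -- s(y), lies in the chart domain at `m₀`; this is why `sliceDomain` includes that condition.
    have hleft := (chartAt (EuclideanSpace ℝ (Fin r)) (m₀ : M)).left_inv hp5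
    simp only [Function.comp_apply, hs, coordDomain, extChartAt_prod, one_smul]
    refine ⟨⟨?_, ?_⟩, ?_⟩
    · simpa using hp1
    · simpa using (chartAt (EuclideanSpace ℝ (Fin r)) (m₀ : M)).map_source hp5
    · rw [extChartAt_source]
      change groupSlice G L p.1 • (chartAt (EuclideanSpace ℝ (Fin r)) (m₀ : M)).symm
        (chartAt (EuclideanSpace ℝ (Fin r)) (m₀ : M)
          (s ((chartAt (EuclideanSpace ℝ (Fin q)) (orbitProj G U m₀)).symm p.2))) ∈
            (chartAt (EuclideanSpace ℝ (Fin r)) (m₀ : M)).source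
      exact hleft.symm ▸ hp4
  · obtain ⟨-, -, hp5⟩ := hAs hp
    have hleft := (chartAt (EuclideanSpace ℝ (Fin r)) (m₀ : M)).left_inv hp5
    simp only [Function.comp_apply, hs]
    simp only [writtenInExtChartAt, extChartAt_prod, one_smul, Function.comp_apply]
    change chartAt (EuclideanSpace ℝ (Fin r)) (m₀ : M)
      (groupSlice G L p.1 • (chartAt (EuclideanSpace ℝ (Fin r)) (m₀ : M)).symm
        (chartAt (EuclideanSpace ℝ (Fin r)) (m₀ : M)
          (s ((chartAt (EuclideanSpace ℝ (Fin q)) (orbitProj G U m₀)).symm p.2)))) = _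
    exact congrArg _ (congrArg _ hleft)

variable {k : ℕ} {F : Type} [NormedAddCommGroup F] [NormedSpace ℝ F]
  {Q : (EuclideanSpace ℝ (Fin k) × F) ≃L[ℝ] EuclideanSpace ℝ (Fin d)}
  (σ : SliceChart d r q m₀ s (Q.toContinuousLinearMap.comp
    (ContinuousLinearMap.inl ℝ (EuclideanSpace ℝ (Fin k)) F)))

/-- In coordinates Θ is the inverse of the chart expression Φ of `sliceParam`, followed by the
affine map (u, y) ↦ c + Q(u, 0). Φ is built from ρ, s and affine maps, and its derivative is
invertible throughout, so a single inversion suffices and no primitive has to be taken. -/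
theorem mapConstructible_theta [IsManifold (𝓡 r) ∞ M]
    (hsm₀ : s (orbitProj G U m₀) = m₀) :
    MapConstructible r d (ActionData d r q U m₀ s) ⟨m₀, σ.base_mem hsm₀⟩ σ.theta := by
  let L := Q.toContinuousLinearMap.comp
    (ContinuousLinearMap.inl ℝ (EuclideanSpace ℝ (Fin k)) F)
  set φ := chartAt (EuclideanSpace ℝ (Fin r)) (m₀ : M) with hφ
  let Φ := (φ.symm.trans σ.chart).symm
  have hsource : Φ.source = σ.chart.target := by
    change (φ.symm.trans σ.chart).target = _
    rw [OpenPartialHomeomorph.trans_target]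
    exact Set.inter_eq_left.2 fun p hp => (σ.domain_subset _ (σ.chart.map_target hp)).2
  have hΦ : Set.EqOn (φ ∘ sliceParam (q := q) m₀ s L) Φ σ.chart.target := fun p hp =>
    congrArg φ (σ.symm_apply p hp).symm
  have hΦs : ContDiffOn ℝ ∞ Φ Φ.source := by
    rw [← contMDiffOn_iff_contDiffOn]
    exact contMDiffOn_chart.comp (σ.contMDiffOn_symm.mono fun p hp => hp.1) fun p hp => hp.2
  have hΦs' : ContDiffOn ℝ ∞ Φ.symm Φ.target := by
    rw [← contMDiffOn_iff_contDiffOn]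
    exact σ.contMDiffOn.comp (contMDiffOn_chart_symm.mono fun p hp => hp.1) fun p hp => hp.2
  have h1 : ConstructibleUpToQuadratures (ActionData d r q U m₀ s) _ _ Φ.source Φ :=
    .restrict (constructible_chart_comp_sliceParam L hsm₀ σ.chart.open_target σ.target_subset)
      Φ.open_source hsource.subset (hsource.symm ▸ hΦ)
  have h2 : ConstructibleUpToQuadratures (ActionData d r q U m₀ s) _ _ (Φ '' Φ.source) Φ.symm :=
    .inverse h1 Φ.open_source hΦs (fun p hp => Φ.bijective_fderiv hΦs hΦs' hp)
      fun p hp => Φ.left_inv hp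
  have h3 := ConstructibleUpToQuadratures.comp h2
    (.affine (L.comp (ContinuousLinearMap.fst ℝ _ (EuclideanSpace ℝ (Fin q))))
      (chartAt (EuclideanSpace ℝ (Fin d)) (1 : G) 1)) (Set.mapsTo_univ _ _)
  -- The preferred chart of V at `m₀` is the restriction of that of M; its target lies in
  -- `Φ.target`, where `Φ.symm` is known.
  have htarget : (extChartAt (𝓡 r) (⟨m₀, σ.base_mem hsm₀⟩ : σ.domain)).target =
      (φ.subtypeRestr σ.nonempty_domain).target := by
    simp [TopologicalSpace.Opens.chartAt_eq, hφ]
  refine ⟨fun x => ⟨?_, ?_⟩, ?_⟩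
  · rw [extChartAt_source]
    change x ∈ (φ.subtypeRestr σ.nonempty_domain).source
    rw [φ.subtypeRestr_source]
    exact (σ.domain_subset x x.2).2
  · rw [σ.theta_base hsm₀, extChartAt_source]
    exact σ.theta_mem_source x
  · rw [htarget]
    have hmem : ∀ x ∈ (φ.subtypeRestr σ.nonempty_domain).target, φ.symm x =
        ((φ.subtypeRestr σ.nonempty_domain).symm x : M) := fun x hx =>
      (φ.subtypeRestr_symm_apply σ.nonempty_domain hx).symm
    refine .restrict h3 (OpenPartialHomeomorph.open_target _) (fun x hx => ?_) fun x hx => ?_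
    · rw [Φ.image_source_eq_target]
      refine ⟨φ.subtypeRestr_target_subset _ hx, ?_⟩
      change φ.symm x ∈ σ.chart.source
      rw [hmem x hx]
      exact ((φ.subtypeRestr σ.nonempty_domain).symm x).2
    · have h4 := σ.chart_theta ((φ.subtypeRestr σ.nonempty_domain).symm x)
      simp only [writtenInExtChartAt, σ.theta_base hsm₀, Function.comp_apply]
      change Q ((σ.chart (φ.symm x)).1, 0) + _ =
        chartAt (EuclideanSpace ℝ (Fin d)) (1 : G)
          (σ.theta ((φ.subtypeRestr σ.nonempty_domain).symm x))
      rw [h4, ← hmem x hx, add_comm]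

end SliceChart

/-! ### Assembly of the theorem -/

/-- The description of the vertical spaces of `π|_U` by the action is inherited by smaller open
subsets. -/
theorem mfderiv_orbitProj_eq_zero_iff_of_le {d r q : ℕ}
    {G : Type*} [Group G] [TopologicalSpace G] [ChartedSpace (EuclideanSpace ℝ (Fin d)) G]
    {M : Type*} [TopologicalSpace M] [ChartedSpace (EuclideanSpace ℝ (Fin r)) M] [MulAction G M]
    {U V : TopologicalSpace.Opens M} (hVU : V ≤ U)
    [ChartedSpace (EuclideanSpace ℝ (Fin q)) (orbitImage G U)]
    [ChartedSpace (EuclideanSpace ℝ (Fin q)) (orbitImage G V)]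
    (hπU : ContMDiff (𝓡 r) (𝓡 q) ∞ (orbitProj G U))
    (hπV : ContMDiff (𝓡 r) (𝓡 q) ∞ (orbitProj G V))
    (hj : IsLocalDiffeomorph (𝓡 q) (𝓡 q) ∞ (Set.inclusion (orbitImage_mono G hVU)))
    (hker : ∀ (m : U) (v : TangentSpace (𝓡 r) m), mfderiv (𝓡 r) (𝓡 q) (orbitProj G U) m v = 0 ↔
      ∃ ξ : TangentSpace (𝓡 d) (1 : G), mfderiv (𝓡 d) (𝓡 r) (fun g : G => g • (m : M)) 1 ξ =
          mfderiv (𝓡 r) (𝓡 r) (Subtype.val : U → M) m v)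
    (m : V) (v : TangentSpace (𝓡 r) m) :
    mfderiv (𝓡 r) (𝓡 q) (orbitProj G V) m v = 0 ↔
      ∃ ξ : TangentSpace (𝓡 d) (1 : G), mfderiv (𝓡 d) (𝓡 r) (fun g : G => g • (m : M)) 1 ξ =
          mfderiv (𝓡 r) (𝓡 r) (Subtype.val : V → M) m v := by
  let ι : V → U := TopologicalSpace.Opens.inclusion hVU
  have hι : HasMFDerivAt (𝓡 r) (𝓡 r) ι m (mfderiv (𝓡 r) (𝓡 r) ι m) :=
    ((contMDiff_inclusion hVU m).mdifferentiableAt (n := ∞) (by simp)).hasMFDerivAt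
  have hU := ((hπU (ι m)).mdifferentiableAt (by simp)).hasMFDerivAt
  have hV := ((hπV m).mdifferentiableAt (by simp)).hasMFDerivAt
  have hj' := ((hj.contMDiff (orbitProj G V m)).mdifferentiableAt (by simp)).hasMFDerivAt
  have hval := ((contMDiff_subtype_val (ι m)).mdifferentiableAt (I := 𝓡 r) (n := ∞)
    (by simp)).hasMFDerivAt
  -- The two sides differentiate the same map: π|_V followed by π(V) → π(U) equals the inclusion V →
  -- U followed by π|_U.
  have h1 := congrArg (fun L => L v) (hasMFDerivAt_unique (hj'.comp m hV) (hU.comp m hι))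
  have h2 := congrArg (fun L => L v) (hval.comp m hι).mfderiv
  have hinj := ((hj (orbitProj G V m)).mfderivToContinuousLinearEquiv (by simp)).injective
  have h3 : mfderiv (𝓡 r) (𝓡 q) (orbitProj G V) m v = 0 ↔
      mfderiv (𝓡 r) (𝓡 q) (orbitProj G U) (ι m) (mfderiv (𝓡 r) (𝓡 r) ι m v) = 0 := by
    constructor
    · intro h
      refine h1.symm.trans ?_
      exact (congrArg (mfderiv (𝓡 q) (𝓡 q) _ (orbitProj G V m)) h).trans (map_zero _)
    · intro h
      exact hinj ((h1.trans h).trans (map_zero _).symm)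
  refine (h3.trans (hker (ι m) _)).trans (exists_congr fun ξ => ?_)
  exact ⟨fun h => h.trans h2.symm, fun h => h.trans h2⟩

theorem mainTheorem7 {d r q : ℕ}
    {G : Type*} [Group G] [TopologicalSpace G] [T2Space G] [SecondCountableTopology G]
    [ChartedSpace (EuclideanSpace ℝ (Fin d)) G] [LieGroup (𝓡 d) ∞ G]
    {M : Type*} [TopologicalSpace M] [T2Space M] [SecondCountableTopology M]
    [ChartedSpace (EuclideanSpace ℝ (Fin r)) M] [IsManifold (𝓡 r) ∞ M]
    [MulAction G M] [ContMDiffSMul (𝓡 d) (𝓡 r) ∞ G M]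
    (m₀ : M) (_hm₀ : IsRegularPoint G d m₀)
    (U : TopologicalSpace.Opens M)
    [ChartedSpace (EuclideanSpace ℝ (Fin q)) (orbitImage G U)]
    (hU : IsAdmissible G d r q m₀ U)
    (s : orbitImage G U → U) (_hs : ContMDiff (𝓡 q) (𝓡 r) ∞ s)
    (_hsec : ∀ y : orbitImage G U, orbitProj G U (s y) = y)
    (_hsm₀ : s (orbitProj G U ⟨m₀, hU.mem⟩) = ⟨m₀, hU.mem⟩) :
    ∃ (V : TopologicalSpace.Opens M) (hVU : V ≤ U)
      (_ : ChartedSpace (EuclideanSpace ℝ (Fin q)) (orbitImage G V))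
      (hV : IsAdmissible G d r q m₀ V),
      -- `π(V)` carries the manifold structure of an open subset of `π(U)`
      IsLocalDiffeomorph (𝓡 q) (𝓡 q) ∞ (Set.inclusion (orbitImage_mono G hVU)) ∧
      -- `s` restricts to a section of `π|_V`
      (∀ y : orbitImage G V, (s (Set.inclusion (orbitImage_mono G hVU) y) : M) ∈ V) ∧
      ∃ (Θ : V → G) (k : ℕ) (_ : ChartedSpace (EuclideanSpace ℝ (Fin k)) (Set.range Θ)),
        IsEmbeddedSubmanifold d k (Set.range Θ) ∧
        Manifold.IsSubmersion (𝓡 r) (𝓡 k) ∞ (Set.rangeFactorization Θ) ∧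
        AreTransverse r q k (orbitProj G V) (Set.rangeFactorization Θ) ∧
        Θ ⟨m₀, hV.mem⟩ = 1 ∧
        (∀ m : V, Θ m • (s (orbitProj G U ⟨m, hVU m.2⟩) : M) = m) ∧
        MapConstructible r d (ActionData d r q U ⟨m₀, hU.mem⟩ s) ⟨m₀, hV.mem⟩ Θ := by
  have := hU.manifold.smooth
  have := hU.manifold.t2
  have := hU.manifold.secondCountable
  obtain ⟨k, K, Q, hk, ⟨σ⟩⟩ := exists_sliceChart _hs _hsec _hsm₀ hU.submersion.contMDiff
    (hU.ker_eq ⟨m₀, hU.mem⟩)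
  let _ : ChartedSpace (EuclideanSpace ℝ (Fin q)) (orbitImage G σ.domain) :=
    (σ.orbitChart _hsec).singletonChartedSpace (σ.orbitChart_source _hsec)
  let _ : ChartedSpace (EuclideanSpace ℝ (Fin k)) (Set.range σ.theta) :=
    σ.thetaChart.singletonChartedSpace rfl
  have hj := σ.isLocalDiffeomorph_inclusion _hsec
  have : T2Space (orbitImage G σ.domain) := (σ.isOpenEmbedding_inclusion _hsec).isEmbedding.t2Space
  have : SecondCountableTopology (orbitImage G σ.domain) :=
    (σ.isOpenEmbedding_inclusion _hsec).isEmbedding.secondCountableTopology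
  have hman : IsSmoothManifold q (orbitImage G σ.domain) :=
    (σ.orbitChart _hsec).isSmoothManifold_singleton (σ.orbitChart_source _hsec)
  have := hman.smooth
  have hemb : IsEmbeddedSubmanifold d k (Set.range σ.theta) := σ.isEmbeddedSubmanifold_range_theta
  have := hemb.manifold.smooth
  -- Any linear isomorphism will do, and k + q = r provides one; `T'` swaps the factors so that π
  -- becomes a first projection as well.
  let T : EuclideanSpace ℝ (Fin r) ≃L[ℝ] EuclideanSpace ℝ (Fin k) × EuclideanSpace ℝ (Fin q) :=
    ContinuousLinearEquiv.ofFinrankEq (by simp [hk])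
  let T' := T.trans (ContinuousLinearEquiv.prodComm ℝ _ _)
  have hψ := σ.euclideanChart_mem_maximalAtlas T
  have hψs := σ.euclideanChart_source T
  have heq : ∀ m, σ.orbitChart _hsec (orbitProj G σ.domain m) = (T' (σ.euclideanChart T m)).1 :=
    fun m => (σ.orbitChart_orbitProj _hsec m).trans
      (congrArg Prod.snd (σ.euclideanChart_apply T m)).symm
  have heq' : ∀ m, σ.thetaChart (Set.rangeFactorization σ.theta m) =
      (T (σ.euclideanChart T m)).1 :=
    fun m => (σ.thetaChart_theta m).trans (congrArg Prod.fst (σ.euclideanChart_apply T m)).symm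
  have hq := (σ.orbitChart _hsec).mem_maximalAtlas_singleton (σ.orbitChart_source _hsec)
  have hθ := σ.thetaChart.mem_maximalAtlas_singleton rfl
  have hsub : Manifold.IsSubmersion (𝓡 r) (𝓡 q) ∞ (orbitProj G σ.domain) :=
    isSubmersion_of_global_charts _ hψ hψs _ hq (σ.orbitChart_source _hsec) T' heq
  have hsub' : Manifold.IsSubmersion (𝓡 r) (𝓡 k) ∞ (Set.rangeFactorization σ.theta) :=
    isSubmersion_of_global_charts _ hψ hψs _ hθ rfl T heq'
  obtain ⟨l, hl, hl'⟩ := hU.isotropy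
  refine ⟨σ.domain, σ.domain_le, inferInstance, ?_, hj, ?_, σ.theta, k, inferInstance, hemb, hsub',
    ?_, σ.theta_base _hsm₀ _, σ.theta_smul _hsec, σ.mapConstructible_theta _hsm₀⟩
  · exact ⟨σ.base_mem _hsm₀, σ.isConnected_domain, ⟨l, hl, fun m hm => hl' m (σ.domain_le hm)⟩,
      hman, hsub, mfderiv_orbitProj_eq_zero_iff_of_le σ.domain_le hU.submersion.contMDiff
        hsub.contMDiff hj hU.ker_eq⟩
  · rintro ⟨_, m, hm, rfl⟩
    have h := σ.section_mem (σ.chart.map_source hm)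
    rwa [← σ.orbitProj_eq _hsec ⟨m, hm⟩] at h
  · exact areTransverse_of_global_charts _ hψ hψs _ hq (σ.orbitChart_source _hsec) _ hθ rfl T'
      hsub.contMDiff heq hsub'.contMDiff heq'
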